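/- Let $(a_n)_{n\ge 0}$ be an exponentially bounded sequence of complex numbers ($|a_n|\le C R^n$ for some $C,R>0$) with generating function $G(z)=\sum_{n\ge0}a_nz^n$. Let $r,\varepsilon>0$ and let $L$ be a finite nonempty set of complex numbers of modulus $r$. Suppose that: (1) $G$ extends analytically to the disk $|z|<r$, and further to the disk $|z|<r+\varepsilon$ with the radial slits $\{tp: t\ge 1\}$, $p\in L$, removed; (2) each $p\in L$ is a singularity of $G$: the function $G$ on $|z|<r$ does not continue analytically to a neighbourhood of $p$; (3) $G$ has quasi-unipotent local monodromy (of regular singular type) at each $p\in L$: near $p$, $G$ continues to a multivalued analytic function on a punctured disk centred at $p$, whose branches span a finite-dimensional complex vector space and have moderate growth at $p$ (on each sector of finite opening in the universal cover of the punctured disk they are bounded by $C|z-p|^{-N}$ for some $C,N$), and every eigenvalue of the monodromy operator on the space spanned by the branches is a root of unity. Then $(a_n)$ is of Nilsson type. That is, there are a finite set $S\subset\mathbb Q$, a number $d\in\mathbb N$, a finite set $\Lambda$ of complex numbers of equal magnitude $\rho>0$, and complex numbers $c_{\omega,\lambda}$ for $\omega\in\Omega=(S+\mathbb N)\times\{0,\dots,d\}$,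 $\lambda\in\Lambda$, not all zero, such that, with $h_{(\alpha,\beta)}(n)=(\log n)^\beta/n^\alpha$ and $\Omega$ ordered by $(\alpha,\beta)<(\alpha',\beta')$ if and only if $\alpha<\alpha'$, or $\alpha=\alpha'$ and $\beta'<\beta$, for every $\omega\in\Omega$ $$\Bigl(a_n\rho^{-n}-\sum_{\omega'\le\omega}h_{\omega'}(n)\sum_{\lambda\in\Lambda}c_{\omega',\lambda}(\lambda\rho^{-1})^n\Bigr)\frac1{h_\omega(n)}\to 0\qquad(n\to\infty).$$ -/

import Mathlib

open Filter Topology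

/-- `(a_n)` is exponentially bounded: `|a_n| ≤ C R^n` for all `n`. -/
def ExponentiallyBounded (a : ℕ → ℂ) : Prop :=
  ∃ C R : ℝ, 0 < C ∧ 0 < R ∧ ∀ n, ‖a n‖ ≤ C * R ^ n

/-! ### Sequences of Nilsson type -/

/-- The index set `Ω = (S + ℕ) × {0, …, d}`, as a set of pairs `(α, β)`. -/
def nilssonIndex (S : Finset ℚ) (d : ℕ) : Set (ℚ × ℕ) :=
  {ω | (∃ s ∈ S, ∃ k : ℕ, ω.1 = s + k) ∧ ω.2 ≤ d}

/-- The order `(α', β') ≤ (α, β)` on `Ω`: either `α' < α`, or `α' = α` and `β ≤ β'`. -/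
def nilssonLE (ω' ω : ℚ × ℕ) : Prop :=
  ω'.1 < ω.1 ∨ (ω'.1 = ω.1 ∧ ω.2 ≤ ω'.2)

/-- Every element of `Ω` has only finitely many elements of `Ω` below it. -/
theorem nilssonSegment_finite (S : Finset ℚ) (d : ℕ) (ω : ℚ × ℕ) :
    {ω' | ω' ∈ nilssonIndex S d ∧ nilssonLE ω' ω}.Finite := by
  have h : (⋃ s ∈ S, (fun k : ℕ => s + (k : ℚ)) '' Set.Iic ⌈ω.1 - s⌉₊).Finite :=
    S.finite_toSet.biUnion fun s _ => (Set.finite_Iic _).image _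
  refine (h.prod (Set.finite_Iic d)).subset ?_
  rintro ⟨α, β⟩ ⟨⟨⟨s, hs, k, hk⟩, hβ⟩, hle⟩
  refine ⟨?_, hβ⟩
  simp only [Set.mem_iUnion]
  refine ⟨s, hs, k, ?_, hk.symm⟩
  have hα : α ≤ ω.1 := by
    rcases hle with h | ⟨h, _⟩
    · exact h.le
    · exact h.le
  have h2 : (k : ℚ) ≤ ω.1 - s := by
    simp only at hk
    linarith
  have h3 : (k : ℚ) ≤ (⌈ω.1 - s⌉₊ : ℚ) := h2.trans (Nat.le_ceil _)
  exact_mod_cast h3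

/-- The finite initial segment `{ω' ∈ Ω : ω' ≤ ω}`. -/
noncomputable def nilssonSegment (S : Finset ℚ) (d : ℕ) (ω : ℚ × ℕ) : Finset (ℚ × ℕ) :=
  (nilssonSegment_finite S d ω).toFinset

/-- The Nilsson monomial `h_ω(n) = (log n)^β / n^α` for `ω = (α, β)`. -/
noncomputable def nilssonMonomial (ω : ℚ × ℕ) (n : ℕ) : ℝ :=
  Real.log n ^ ω.2 / (n : ℝ) ^ (ω.1 : ℝ)

/-- The expression `a_n ∼ ∑_{ω ∈ Ω} h_ω(n) ∑_{l ∈ L} c_{ω,l} l^n`, where `Ω` is given by `S`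
and `d`, and the elements of the finite set `L` have magnitude `ρ`. -/
def HasNilssonExpansion (a : ℕ → ℂ) (S : Finset ℚ) (d : ℕ) (ρ : ℝ) (L : Finset ℂ)
    (c : ℚ × ℕ → ℂ → ℂ) : Prop :=
  (∀ ω ∈ nilssonIndex S d,
    Tendsto
      (fun n : ℕ =>
        (a n / (ρ : ℂ) ^ n -
          ∑ ω' ∈ nilssonSegment S d ω,
            (nilssonMonomial ω' n : ℂ) * ∑ l ∈ L, c ω' l * (l / (ρ : ℂ)) ^ n) /
          (nilssonMonomial ω n : ℂ))
      atTop (𝓝 0)) ∧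
  ∃ ω ∈ nilssonIndex S d, ∃ l ∈ L, c ω l ≠ 0

/-- `(a_n)` is a sequence of Nilsson type. -/
def IsNilssonType (a : ℕ → ℂ) : Prop :=
  ∃ (S : Finset ℚ) (d : ℕ) (ρ : ℝ) (L : Finset ℂ) (c : ℚ × ℕ → ℂ → ℂ),
    0 < ρ ∧ (∀ l ∈ L, ‖l‖ = ρ) ∧ HasNilssonExpansion a S d ρ L c

/-! ### The domain of the generating function and its singularities -/

/-- The open disk of radius `r + ε` about `0`, with the radial slits that emanate outwards from
the points of `L` removed. When all points of `L` have modulus `r`, it contains the open disk of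
radius `r`. -/
def slitDisk (r ε : ℝ) (L : Finset ℂ) : Set ℂ :=
  {z | ‖z‖ < r + ε ∧ ∀ l ∈ L, ∀ t : ℝ, 1 ≤ t → z ≠ (t : ℂ) * l}

/-- The boundary point `p` of the open disk of radius `r` is a singularity of `G`: the function
`G` on that disk has no analytic continuation to a neighbourhood of `p`. -/
def IsSingularBoundaryPoint (G : ℂ → ℂ) (r : ℝ) (p : ℂ) : Prop :=
  ¬ ∃ g : ℂ → ℂ, AnalyticAt ℂ g p ∧ ∀ᶠ z in 𝓝[Metric.ball 0 r] p, G z = g z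

/-! ### Local monodromy

For `p ≠ 0`, the punctured disk `0 < |z - p| < δ |p|` has the universal covering
`w ↦ p (1 - e^w)` with total space `logDisk δ`. A multivalued analytic function on the punctured
disk is an analytic function on `logDisk δ`. The radial slit going outwards from `p` lies below the
lines `Im w ∈ π + 2 π ℤ`, so that the slit punctured disk lifts to the strip `|Im w| < π`.
-/

/-- The universal cover of a punctured disk of (relative) radius `δ`. -/
def logDisk (δ : ℝ) : Set ℂ :=
  {w | ‖Complex.exp w‖ < δ}

/-- Translates by `2 π i k` preserve the universal cover. -/
theorem add_mem_logDisk {δ : ℝ} (k : ℤ) {w : ℂ} (hw : w ∈ logDisk δ) :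
    w + k * (2 * Real.pi * Complex.I) ∈ logDisk δ := by
  have h := Complex.exp_periodic.int_mul k w
  simp only [logDisk, Set.mem_ofPred_eq] at hw ⊢
  rw [h]
  exact hw

/-- The deck transformation `w ↦ w + 2 π i k`: going `k` times around the puncture. -/
noncomputable def deckShift (δ : ℝ) (k : ℤ) (w : logDisk δ) : logDisk δ :=
  ⟨w + k * (2 * Real.pi * Complex.I), add_mem_logDisk k w.2⟩

/-- The monodromy operator `(T f)(w) = f(w + 2 π i)` on functions on the universal cover. -/
noncomputable def monodromy (δ : ℝ) : Module.End ℂ (logDisk δ → ℂ) :=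
  LinearMap.funLeft ℂ ℂ (deckShift δ 1)

/-- The space spanned by all branches `w ↦ f(w + 2 π i k)`, `k ∈ ℤ`, of a multivalued function. -/
noncomputable def branchSpace (δ : ℝ) (f : logDisk δ → ℂ) : Submodule ℂ (logDisk δ → ℂ) :=
  Submodule.span ℂ (Set.range fun k : ℤ => f ∘ deckShift δ k)

/-- Moderate growth at the puncture: in every sector, that is, on every horizontal strip of
finite width of the universal cover, `f` is bounded by a power of `1 / |e^w|`. -/
def HasModerateGrowth (δ : ℝ) (f : ℂ → ℂ) : Prop :=
  ∀ M : ℝ, ∃ (C : ℝ) (N : ℕ), ∀ w ∈ logDisk δ, |w.im| ≤ M →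
    ‖f w‖ ≤ C * (‖Complex.exp w‖⁻¹) ^ N

/-- The function `G`, defined near `p ≠ 0` off the radial slit that goes outwards from `p`, has
quasi-unipotent local monodromy at `p`: it continues to a multivalued analytic function `f` on a
punctured disk about `p`, which is of finite determination (its branches span a
finite-dimensional space) and of moderate growth, and all eigenvalues of the monodromy on the
space spanned by the branches are roots of unity. -/
def HasQuasiUnipotentMonodromyAt (G : ℂ → ℂ) (p : ℂ) : Prop :=
  ∃ δ : ℝ, 0 < δ ∧ ∃ f : ℂ → ℂ,
    DifferentiableOn ℂ f (logDisk δ) ∧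
    (∀ w ∈ logDisk δ, |w.im| < Real.pi → f w = G (p * (1 - Complex.exp w))) ∧
    HasModerateGrowth δ f ∧
    FiniteDimensional ℂ (branchSpace δ ((logDisk δ).domRestrict f)) ∧
    ∀ (μ : ℂ) (v : logDisk δ → ℂ), v ∈ branchSpace δ ((logDisk δ).domRestrict f) →
      (monodromy δ).HasEigenvector μ v → ∃ m : ℕ, 0 < m ∧ μ ^ m = 1

/-!
Near `p ∈ L`, quasi-unipotence makes a power `T ^ m` of the monodromy unipotent, so `G`, as a
function of `w = log (1 - z / p)`, is killed by an iterated difference with step `2 π i m`. It is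
therefore a polynomial in `w` with coefficients of period `2 π i m`, which by moderate growth are
convergent Laurent series in `(1 - z / p) ^ (1 / m)`.

The vectors of Taylor coefficients of `(1 - z) ^ α * log (1 - z) ^ j`, `j ≤ β`, satisfy a
recurrence `x (n + 1) = (n - T) / (n + 1) • x n`; for `n ^ (T + 1) • x n` the transition becomes
`1 + O(n⁻²)`, analytic in `1 / n`, and such an equation has solutions with a full expansion in
powers of `1 / n`. Subtracting long truncations of the local expansions at all `p ∈ L` leaves a
function whose `J`-th derivative is bounded on `‖z‖ < r`, so the Cauchy estimate bounds the error
in `a n * r ^ n` by `O(n ^ (-J))`.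

If all Nilsson coefficients vanished, `a n * r ^ n` would decay faster than every power of `n`,
and `G` would have a Taylor expansion to all orders along the radius to each `p ∈ L`. By
uniqueness of expansions no logarithms and no fractional or negative powers could occur in the
log-Puiseux form at `p`, so `G` would continue analytically to `p`.
-/

/-! ### Difference equations with an analytic transition operator -/

section AnalyticVanishing

variable {𝕜 V : Type*} [NontriviallyNormedField 𝕜] [NormedAddCommGroup V] [NormedSpace 𝕜 V]

theorem exists_eventuallyEq_pow_smul_of_isBigO {f : 𝕜 → V} (hf : AnalyticAt 𝕜 f 0) {m : ℕ}
    (hO : f =O[𝓝[≠] 0] fun x => x ^ m) :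
    ∃ g : 𝕜 → V, AnalyticAt 𝕜 g 0 ∧ ∀ᶠ x in 𝓝 0, f x = x ^ m • g x := by
  suffices h : (m : ℕ∞) ≤ analyticOrderAt f 0 by
    simpa only [sub_zero] using (natCast_le_analyticOrderAt hf).1 h
  by_contra! hlt
  obtain ⟨k, hk⟩ := ENat.ne_top_iff_exists.1 hlt.ne_top
  obtain ⟨g, hg, hg0, hfg⟩ := hf.analyticOrderAt_eq_natCast.1 hk.symm
  have hkm : k < m := by rwa [← hk, Nat.cast_lt] at hlt
  have hgO : g =O[𝓝[≠] 0] fun x => x ^ (m - k) := by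
    obtain ⟨C, hC⟩ := hO.bound
    refine .of_bound C ?_
    filter_upwards [hC, hfg.filter_mono nhdsWithin_le_nhds, self_mem_nhdsWithin] with x hx hfx hx0
    have hxk : 0 < ‖x ^ k‖ := norm_pos_iff.2 (pow_ne_zero k hx0)
    rw [hfx, sub_zero, norm_smul, ← Nat.sub_add_cancel hkm.le, pow_add x, norm_mul] at hx
    exact le_of_mul_le_mul_left (by linarith) hxk
  have hpow : Tendsto (fun x : 𝕜 => x ^ (m - k)) (𝓝[≠] 0) (𝓝 0) := by
    have := (continuous_pow (M := 𝕜) (m - k)).tendsto 0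
    rw [zero_pow (Nat.sub_ne_zero_of_lt hkm)] at this
    exact this.mono_left nhdsWithin_le_nhds
  exact hg0 (tendsto_nhds_unique (hg.continuousAt.tendsto.mono_left nhdsWithin_le_nhds)
    (hgO.trans_tendsto hpow))

theorem exists_isLittleO_sub_pow_smul {f : 𝕜 → V} (hf : AnalyticAt 𝕜 f 0) {m : ℕ}
    (hO : f =O[𝓝 0] fun x => x ^ m) :
    ∃ v : V, (fun x => f x - x ^ m • v) =o[𝓝 0] fun x => x ^ m := by
  obtain ⟨g, hg, hfg⟩ := exists_eventuallyEq_pow_smul_of_isBigO hf (hO.mono nhdsWithin_le_nhds)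
  have hg1 : (fun x => g x - g 0) =o[𝓝 0] fun _ => (1 : 𝕜) :=
    (Asymptotics.isLittleO_one_iff 𝕜).2 (tendsto_sub_nhds_zero_iff.2 hg.continuousAt.tendsto)
  refine ⟨g 0, ((Asymptotics.isBigO_refl (fun x : 𝕜 => x ^ m) (𝓝 0)).smul_isLittleO hg1).congr'
    ?_ (.of_eq (funext fun x => mul_one _))⟩
  filter_upwards [hfg] with x hx
  rw [hx, smul_sub]

theorem isBigO_pow_succ_of_isLittleO {f : 𝕜 → V} (hf : AnalyticAt 𝕜 f 0) {m : ℕ}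
    (ho : f =o[𝓝 0] fun x => x ^ m) : f =O[𝓝 0] fun x => x ^ (m + 1) := by
  obtain ⟨g, hg, hfg⟩ :=
    exists_eventuallyEq_pow_smul_of_isBigO hf (ho.isBigO.mono nhdsWithin_le_nhds)
  have hg0 : g 0 = 0 := by
    have hgo : g =o[𝓝[≠] 0] fun _ => (1 : 𝕜) := by
      refine .of_bound fun c hc => ?_
      filter_upwards [(ho.bound hc).filter_mono nhdsWithin_le_nhds,
        hfg.filter_mono nhdsWithin_le_nhds, self_mem_nhdsWithin] with x hx hfx hx0
      have hxm : 0 < ‖x ^ m‖ := norm_pos_iff.2 (pow_ne_zero m hx0)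
      rw [hfx, norm_smul, mul_comm c] at hx
      rw [norm_one, mul_one]
      exact le_of_mul_le_mul_left hx hxm
    exact tendsto_nhds_unique (hg.continuousAt.tendsto.mono_left nhdsWithin_le_nhds)
      ((Asymptotics.isLittleO_one_iff 𝕜).1 hgo)
  have hgO : g =O[𝓝 0] fun x => x := by
    simpa only [sub_zero, hg0] using hg.differentiableAt.isBigO_sub
  refine ((Asymptotics.isBigO_refl (fun x : 𝕜 => x ^ m) (𝓝 0)).smul hgO).congr' ?_ ?_
  · exact EventuallyEq.symm hfg
  · exact .of_eq (funext fun x => (pow_succ x m).symm)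

end AnalyticVanishing

section DifferenceEquation

variable {V : Type*} [NormedAddCommGroup V]

theorem norm_le_of_norm_sub_le_sub {d : ℕ → V} {g : ℕ → ℝ} {N : ℕ}
    (hd : Tendsto d atTop (𝓝 0)) (hg : Tendsto g atTop (𝓝 0))
    (h : ∀ n ≥ N, ‖d (n + 1) - d n‖ ≤ g n - g (n + 1)) {n : ℕ} (hn : N ≤ n) : ‖d n‖ ≤ g n := by
  have hmono : Monotone fun i => ‖d (n + i)‖ - g (n + i) := monotone_nat_of_le_succ fun i => by
    have h₁ := h (n + i) (by omega)
    have h₂ := norm_sub_norm_le (d (n + i)) (d (n + i + 1))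
    rw [norm_sub_rev] at h₂
    simp only [← add_assoc]
    linarith
  have hlim : Tendsto (fun i => ‖d (n + i)‖ - g (n + i)) atTop (𝓝 0) := by
    have hni : Tendsto (fun i => n + i) atTop atTop := tendsto_atTop_mono (Nat.le_add_left · n)
      tendsto_id
    simpa using (hd.norm.comp hni).sub (hg.comp hni)
  simpa using hmono.ge_of_tendsto hlim 0

theorem inv_pow_le_two_pow_mul_sub (k : ℕ) {n : ℕ} (hn : 0 < n) :
    ((n : ℝ) ^ (k + 2))⁻¹ ≤
      2 ^ (k + 1) * (((n : ℝ) ^ (k + 1))⁻¹ - (((n + 1 : ℕ) : ℝ) ^ (k + 1))⁻¹) := by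
  have hn0 : (0 : ℝ) < n := by exact_mod_cast hn
  have hn1 : (1 : ℝ) ≤ n := by exact_mod_cast hn
  have hbern : 1 + (n : ℝ)⁻¹ ≤ (1 + (n : ℝ)⁻¹) ^ (k + 1) :=
    le_self_pow₀ (by simp [hn0.le]) k.succ_ne_zero
  have hsucc : ((n + 1 : ℕ) : ℝ) = n * (1 + (n : ℝ)⁻¹) := by
    push_cast
    field_simp
  have htwo : (1 + (n : ℝ)⁻¹) ^ (k + 1) ≤ 2 ^ (k + 1) := by
    gcongr
    linarith [inv_le_one_of_one_le₀ hn1]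
  set y := (1 + (n : ℝ)⁻¹) ^ (k + 1)
  have hy : 0 < y := by positivity
  have hkey : (n : ℝ)⁻¹ ≤ 2 ^ (k + 1) * (1 - y⁻¹) := by
    calc (n : ℝ)⁻¹ ≤ y - 1 := by linarith
      _ = y * (1 - y⁻¹) := by field_simp
      _ ≤ 2 ^ (k + 1) * (1 - y⁻¹) := by
        gcongr
        have : y⁻¹ ≤ 1 := inv_le_one_of_one_le₀ (by linarith [inv_pos.2 hn0])
        linarith
  calc ((n : ℝ) ^ (k + 2))⁻¹ = ((n : ℝ) ^ (k + 1))⁻¹ * (n : ℝ)⁻¹ := by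
        rw [← mul_inv, ← pow_succ]
    _ ≤ ((n : ℝ) ^ (k + 1))⁻¹ * (2 ^ (k + 1) * (1 - y⁻¹)) := by gcongr
    _ = _ := by
        rw [hsucc, mul_pow, mul_inv]
        ring

theorem tendsto_inv_natCast_pow_succ (k : ℕ) :
    Tendsto (fun n : ℕ => ((n : ℝ) ^ (k + 1))⁻¹) atTop (𝓝 0) :=
  ((tendsto_pow_atTop k.succ_ne_zero).comp tendsto_natCast_atTop_atTop).inv_tendsto_atTop

theorem isBigO_inv_natCast_pow_of_le {j k : ℕ} (hjk : j ≤ k) :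
    (fun n : ℕ => ((n : ℝ) ^ k)⁻¹) =O[atTop] fun n : ℕ => ((n : ℝ) ^ j)⁻¹ := by
  refine .of_bound 1 ((eventually_gt_atTop 0).mono fun n hn => ?_)
  have hn1 : (1 : ℝ) ≤ n := by exact_mod_cast hn
  rw [one_mul, norm_inv, norm_inv, norm_pow, norm_pow, Real.norm_of_nonneg (by positivity)]
  gcongr

theorem isBigO_inv_pow_succ_of_sub {d : ℕ → V} (hd : Tendsto d atTop (𝓝 0)) {k : ℕ}
    (h : (fun n => d (n + 1) - d n) =O[atTop] fun n : ℕ => ((n : ℝ) ^ (k + 2))⁻¹) :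
    d =O[atTop] fun n : ℕ => ((n : ℝ) ^ (k + 1))⁻¹ := by
  obtain ⟨C, hC0, hC⟩ := h.exists_nonneg
  obtain ⟨N, hN⟩ := eventually_atTop.1 (hC.bound.and (eventually_gt_atTop 0))
  have hg : Tendsto (fun n : ℕ => C * 2 ^ (k + 1) * ((n : ℝ) ^ (k + 1))⁻¹) atTop (𝓝 0) := by
    simpa using (tendsto_inv_natCast_pow_succ k).const_mul (C * 2 ^ (k + 1))
  refine .of_bound (C * 2 ^ (k + 1)) (eventually_atTop.2 ⟨N, fun n hn => ?_⟩)
  rw [Real.norm_of_nonneg (by positivity)]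
  refine norm_le_of_norm_sub_le_sub hd hg (fun i hi => (hN i hi).1.trans ?_) hn
  rw [Real.norm_of_nonneg (by positivity), ← mul_sub, mul_assoc]
  exact mul_le_mul_of_nonneg_left (inv_pow_le_two_pow_mul_sub k (hN i hi).2) hC0

theorem isBigO_inv_pow_succ_of_sub_isBigO_add {d : ℕ → V} (hd : Tendsto d atTop (𝓝 0)) {K : ℕ}
    (h : (fun n => d (n + 1) - d n) =O[atTop]
      fun n : ℕ => ((n : ℝ) ^ 2)⁻¹ * ‖d n‖ + ((n : ℝ) ^ (K + 2))⁻¹) :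
    d =O[atTop] fun n : ℕ => ((n : ℝ) ^ (K + 1))⁻¹ := by
  suffices hj : ∀ j ≤ K + 1, d =O[atTop] fun n : ℕ => ((n : ℝ) ^ j)⁻¹ from hj _ le_rfl
  intro j hj
  induction j with
  | zero => simpa using hd.isBigO_one ℝ
  | succ j ih =>
    refine isBigO_inv_pow_succ_of_sub hd (h.trans (.add ?_ ?_))
    · refine ((Asymptotics.isBigO_refl _ atTop).mul (ih (by omega)).norm_left).congr_right
        fun n => ?_
      rw [← mul_inv, ← pow_add, add_comm]
    · simpa using isBigO_inv_natCast_pow_of_le (Nat.add_le_add_right (Nat.le_of_lt_succ hj) 2)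

theorem isBigO_one_of_sub_isBigO_mul {A : ℕ → V} {c : ℕ → ℝ} (hc : Summable c)
    (h : (fun n => A (n + 1) - A n) =O[atTop] fun n => c n * ‖A n‖) :
    A =O[atTop] fun _ => (1 : ℝ) := by
  obtain ⟨C, hC0, hC⟩ := h.exists_nonneg
  obtain ⟨N, hN⟩ := eventually_atTop.1 hC.bound
  have hstep : ∀ n ≥ N, ‖A (n + 1)‖ ≤ (1 + C * |c n|) * ‖A n‖ + 0 := fun n hn => by
    have := hN n hn
    rw [norm_mul, norm_norm, Real.norm_eq_abs] at this
    linarith [norm_le_norm_add_norm_sub' (A (n + 1)) (A n)]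
  refine .of_bound ((‖A N‖ + 0) * Real.exp (∑' i, C * |c i|))
    (eventually_atTop.2 ⟨N, fun n hn => ?_⟩)
  have hgr := discrete_gronwall (u := fun n => ‖A n‖) (b := 0) (norm_nonneg _) hstep
    (fun n _ => by positivity) (fun _ _ => le_rfl) hn
  rw [norm_one, mul_one]
  refine hgr.trans ?_
  simp only [Pi.zero_apply, Finset.sum_const_zero]
  gcongr
  exact (hc.abs.mul_left C).sum_le_tsum _ fun i _ => by positivity

theorem exists_tendsto_of_sub_isBigO_mul [CompleteSpace V] {A : ℕ → V} {c : ℕ → ℝ}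
    (hc : Summable c) (h : (fun n => A (n + 1) - A n) =O[atTop] fun n => c n * ‖A n‖) :
    ∃ v, Tendsto A atTop (𝓝 v) := by
  have hAc : (fun n => A (n + 1) - A n) =O[atTop] c := by
    simpa using h.trans ((Asymptotics.isBigO_refl c atTop).mul
      (isBigO_one_of_sub_isBigO_mul hc h).norm_left)
  exact cauchySeq_tendsto_of_complete (cauchySeq_of_summable_dist
    ((summable_of_isBigO_nat hc hAc.norm_left).congr fun n => by rw [dist_comm, dist_eq_norm]))

end DifferenceEquation

theorem isLittleO_div_one_add_pow_sub (m : ℕ) :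
    (fun x : ℝ => (x / (1 + x)) ^ m - x ^ m + m * x ^ (m + 1)) =o[𝓝 0] fun x => x ^ (m + 1) := by
  have hd : HasDerivAt (fun x : ℝ => ((1 + x) ^ m)⁻¹) (-m) 0 := by
    simpa using (((hasDerivAt_id (0 : ℝ)).const_add 1).pow m).fun_inv (by simp)
  have ho := (Asymptotics.isBigO_refl (fun x : ℝ => x ^ m) (𝓝 0)).mul_isLittleO hd.isLittleO
  refine ho.congr (fun x => ?_) fun x => by rw [sub_zero, pow_succ]
  simp only [add_zero, one_pow, inv_one, sub_zero, smul_eq_mul]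
  rw [div_pow]
  ring

theorem isBigO_apply_sub_self {ι V : Type*} [NormedAddCommGroup V] [NormedSpace ℝ V]
    {l : Filter ι} {R : ι → V →L[ℝ] V} {g : ι → ℝ} (hR : (fun i => R i - 1) =O[l] g) (B : ι → V) :
    (fun i => R i (B i) - B i) =O[l] fun i => g i * ‖B i‖ := by
  refine .trans (.of_bound 1 (.of_forall fun i => ?_))
    (hR.norm_left.mul (Asymptotics.isBigO_refl (fun i => ‖B i‖) l))
  simpa using (R i - 1).le_opNorm (B i)

theorem isBigO_apply_sub_self_const {ι V : Type*} [NormedAddCommGroup V] [NormedSpace ℝ V]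
    {l : Filter ι} {R : ι → V →L[ℝ] V} {g : ι → ℝ} (hR : (fun i => R i - 1) =O[l] g) (v : V) :
    (fun i => R i v - v) =O[l] g :=
  (isBigO_apply_sub_self hR fun _ => v).trans (by
    simpa [mul_comm] using (Asymptotics.isBigO_refl g l).const_mul_left ‖v‖)

section FormalSolution

variable {V : Type*} [NormedAddCommGroup V] [NormedSpace ℝ V] {R : ℝ → V →L[ℝ] V}

/-- The defect of the truncated formal solution `∑ k < K, q k * n ^ (-k)` of the difference
equation `A (n + 1) = R (1 / n) (A n)`, as a function of `x = 1 / n`, for which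
`1 / (n + 1) = x / (1 + x)`. -/
noncomputable def formalDefect (R : ℝ → V →L[ℝ] V) (q : ℕ → V) (K : ℕ) (x : ℝ) : V :=
  ∑ k ∈ Finset.range K, (x / (1 + x)) ^ k • q k - R x (∑ k ∈ Finset.range K, x ^ k • q k)

theorem formalDefect_succ (R : ℝ → V →L[ℝ] V) (q : ℕ → V) (K : ℕ) (x : ℝ) :
    formalDefect R q (K + 1) x =
      formalDefect R q K x + ((x / (1 + x)) ^ K • q K - x ^ K • R x (q K)) := by
  simp only [formalDefect, Finset.sum_range_succ, map_add, map_smul]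
  abel

theorem formalDefect_congr {q q' : ℕ → V} {K : ℕ} (h : ∀ k < K, q k = q' k) :
    formalDefect R q K = formalDefect R q' K := by
  have hsum (g : ℕ → ℝ) : ∑ k ∈ Finset.range K, g k • q k = ∑ k ∈ Finset.range K, g k • q' k :=
    Finset.sum_congr rfl fun k hk => by rw [h k (Finset.mem_range.1 hk)]
  funext x
  simp only [formalDefect, hsum]

theorem analyticAt_formalDefect (hR : AnalyticAt ℝ R 0) (q : ℕ → V) (K : ℕ) :
    AnalyticAt ℝ (formalDefect R q K) 0 := by
  have hdiv : AnalyticAt ℝ (fun x : ℝ => x / (1 + x)) 0 :=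
    analyticAt_id.fun_div (analyticAt_const.add analyticAt_id) (by simp)
  have hsum {g : ℝ → ℝ} (hg : AnalyticAt ℝ g 0) :
      AnalyticAt ℝ (fun x => ∑ k ∈ Finset.range K, g x ^ k • q k) 0 :=
    Finset.analyticAt_fun_sum _ fun k _ => (hg.fun_pow k).smul analyticAt_const
  have happ := (ContinuousLinearMap.id ℝ (V →L[ℝ] V)).analyticAt_bilinear
  exact (hsum hdiv).sub ((happ _).comp₂ hR (hsum analyticAt_id))

theorem exists_isBigO_formalDefect_update (hR : AnalyticAt ℝ R 0)
    (hR1 : (fun x => R x - 1) =O[𝓝 0] fun x => x ^ 2) {q : ℕ → V} {K : ℕ}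
    (hq : formalDefect R q (K + 1) =O[𝓝 0] fun x => x ^ (K + 2)) :
    ∃ v, formalDefect R (Function.update q (K + 1) v) (K + 2) =O[𝓝 0] fun x => x ^ (K + 3) := by
  obtain ⟨D, hD⟩ := exists_isLittleO_sub_pow_smul (analyticAt_formalDefect hR q (K + 1)) hq
  -- Setting the coefficient `q (K + 1)` to `v` changes the defect by `-(K + 1) x ^ (K + 2) • v` to
  -- leading order, so this `v` cancels its first nonvanishing term `x ^ (K + 2) • D`.
  set v : V := ((K + 1 : ℕ) : ℝ)⁻¹ • D
  refine ⟨v, isBigO_pow_succ_of_isLittleO (analyticAt_formalDefect hR _ _) ?_⟩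
  have hRv : (fun x => x ^ (K + 1) • (R x v - v)) =o[𝓝 0] fun x : ℝ => x ^ (K + 2) := by
    have hlin : (fun x => R x v - v) =o[𝓝 0] fun x : ℝ => x :=
      (isBigO_apply_sub_self_const hR1 v).trans_isLittleO
        (Asymptotics.isLittleO_pow_id one_lt_two)
    refine ((Asymptotics.isBigO_refl (fun x : ℝ => x ^ (K + 1)) (𝓝 0)).smul_isLittleO
      hlin).congr_right fun x => (pow_succ x (K + 1)).symm
  have hpow : (fun x : ℝ => ((x / (1 + x)) ^ (K + 1) - x ^ (K + 1) +
      (K + 1 : ℕ) * x ^ (K + 2)) • v) =o[𝓝 0] fun x => x ^ (K + 2) := by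
    simpa using (isLittleO_div_one_add_pow_sub (K + 1)).smul_isBigO
      (Asymptotics.isBigO_const_const v (one_ne_zero (α := ℝ)) (𝓝 0))
  refine ((hD.add hpow).sub hRv).congr_left fun x => ?_
  have hvD : ((K + 1 : ℕ) : ℝ) • v = D := smul_inv_smul₀ (Nat.cast_ne_zero.2 K.succ_ne_zero) D
  rw [formalDefect_succ R _ (K + 1), Function.update_self,
    formalDefect_congr fun k hk => Function.update_of_ne hk.ne _ _, ← hvD]
  module

theorem exists_formal_solution (hR : AnalyticAt ℝ R 0)
    (hR1 : (fun x => R x - 1) =O[𝓝 0] fun x => x ^ 2) (v : V) :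
    ∃ q : ℕ → V, q 0 = v ∧
      ∀ K, formalDefect R q (K + 1) =O[𝓝 0] fun x => x ^ (K + 2) := by
  have hbase : formalDefect R (fun _ => v) 1 =O[𝓝 0] fun x => x ^ 2 := by
    refine (isBigO_apply_sub_self_const hR1 v).neg_left.congr_left fun x => ?_
    simp [formalDefect]
  choose! next hnext using fun (K : ℕ) (q : ℕ → V) =>
    exists_isBigO_formalDefect_update hR hR1 (q := q) (K := K)
  let s : ℕ → ℕ → V := fun K =>
    K.rec (fun _ => v) fun K q => Function.update q (K + 1) (next K q)
  have hs (K : ℕ) : formalDefect R (s K) (K + 1) =O[𝓝 0] fun x => x ^ (K + 2) := by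
    induction K with
    | zero => exact hbase
    | succ K ih => exact hnext K (s K) ih
  have hstable (K k : ℕ) (hk : k ≤ K) : s K k = s k k := by
    induction K, hk using Nat.le_induction with
    | base => rfl
    | succ K hk ih => exact (Function.update_of_ne (Nat.lt_succ_of_le hk).ne _ _).trans ih
  refine ⟨fun k => s k k, rfl, fun K => ?_⟩
  rw [← formalDefect_congr fun k hk => hstable K k (Nat.lt_succ_iff.1 hk)]
  exact hs K

theorem isBigO_inv_natCast_pow {W : Type*} [Norm W] {f : ℝ → W} {m : ℕ}
    (hf : f =O[𝓝 0] fun x => x ^ m) :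
    (fun n : ℕ => f (n : ℝ)⁻¹) =O[atTop] fun n : ℕ => ((n : ℝ) ^ m)⁻¹ := by
  simpa only [Function.comp_def, inv_pow] using
    hf.comp_tendsto (tendsto_inv_atTop_nhds_zero_nat (𝕜 := ℝ))

theorem exists_expansion_of_difference_equation [CompleteSpace V] (hR : AnalyticAt ℝ R 0)
    (hR1 : (fun x => R x - 1) =O[𝓝 0] fun x => x ^ 2) {A : ℕ → V}
    (hA : ∀ᶠ n : ℕ in atTop, A (n + 1) = R (n : ℝ)⁻¹ (A n)) :
    ∃ q : ℕ → V, ∀ K, (fun n : ℕ => A n - ∑ k ∈ Finset.range K, ((n : ℝ)⁻¹) ^ k • q k) =O[atTop]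
      fun n : ℕ => ((n : ℝ) ^ K)⁻¹ := by
  have hRA := isBigO_apply_sub_self (isBigO_inv_natCast_pow hR1)
  obtain ⟨v, hv⟩ := exists_tendsto_of_sub_isBigO_mul (Real.summable_nat_pow_inv.2 one_lt_two)
    ((hRA A).congr' (hA.mono fun n hn => congrArg (· - A n) hn.symm) .rfl)
  obtain ⟨q, hq0, hq⟩ := exists_formal_solution hR hR1 v
  refine ⟨q, fun K => ?_⟩
  set D : ℕ → V := fun n => A n - ∑ k ∈ Finset.range (K + 1), ((n : ℝ)⁻¹) ^ k • q k with hD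
  have hD0 : Tendsto D atTop (𝓝 0) := by
    have hw : Tendsto (fun x : ℝ => ∑ k ∈ Finset.range (K + 1), x ^ k • q k) (𝓝 0) (𝓝 v) := by
      refine Continuous.tendsto' (by fun_prop) _ _ ?_
      simp [Finset.sum_range_succ', hq0]
    rw [← sub_self v]
    exact hv.sub (hw.comp tendsto_inv_atTop_nhds_zero_nat)
  have hdefect : (fun n => D (n + 1) - D n - (R (n : ℝ)⁻¹ (D n) - D n)) =O[atTop]
      fun n : ℕ => ((n : ℝ) ^ (K + 2))⁻¹ := by
    refine (isBigO_inv_natCast_pow (hq K)).neg_left.congr' ?_ .rfl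
    filter_upwards [hA, eventually_gt_atTop 0] with n hn hn0
    have hinv : (n : ℝ)⁻¹ / (1 + (n : ℝ)⁻¹) = ((n + 1 : ℕ) : ℝ)⁻¹ := by
      push_cast
      field_simp
    simp only [hD, formalDefect, hn, map_sub, hinv]
    abel
  have hDO : D =O[atTop] fun n : ℕ => ((n : ℝ) ^ (K + 1))⁻¹ := by
    refine isBigO_inv_pow_succ_of_sub_isBigO_add hD0 ?_
    refine ((hRA D).add_add hdefect).congr (fun n => by abel) fun n => ?_
    rw [Real.norm_of_nonneg (by positivity), Real.norm_of_nonneg (by positivity)]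
  have hlast : (fun n : ℕ => ((n : ℝ)⁻¹) ^ K • q K) =O[atTop] fun n : ℕ => ((n : ℝ) ^ K)⁻¹ :=
    .of_bound ‖q K‖ (.of_forall fun n => by rw [norm_smul, inv_pow, mul_comm])
  refine ((hDO.trans (isBigO_inv_natCast_pow_of_le K.le_succ)).add hlast).congr_left fun n => ?_
  simp only [hD, Finset.sum_range_succ]
  abel

end FormalSolution

section EulerRecurrence

variable {V : Type*} [NormedAddCommGroup V] [NormedSpace ℝ V] [CompleteSpace V]

/-- The transition operator `(1 + x) ^ T * (1 - x * T)`. -/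
noncomputable def eulerTransition (T : V →L[ℝ] V) (x : ℝ) : V →L[ℝ] V :=
  NormedSpace.exp (Real.log (1 + x) • T) * (1 - x • T)

theorem analyticAt_eulerTransition (T : V →L[ℝ] V) : AnalyticAt ℝ (eulerTransition T) 0 := by
  have hlog : AnalyticAt ℝ (fun x : ℝ => Real.log (1 + x)) 0 :=
    (analyticAt_const.add analyticAt_id).log (by simp)
  exact ((NormedSpace.exp_analytic (𝕂 := ℝ) _).comp (hlog.smul analyticAt_const)).mul
    (analyticAt_const.sub (analyticAt_id.smul analyticAt_const))

theorem isBigO_eulerTransition_sub_one (T : V →L[ℝ] V) :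
    (fun x => eulerTransition T x - 1) =O[𝓝 0] fun x => x ^ 2 := by
  have hlog : HasDerivAt (fun x : ℝ => Real.log (1 + x)) 1 0 := by
    simpa using ((hasDerivAt_id (0 : ℝ)).const_add 1).log (by simp)
  have hexp : HasDerivAt (fun x : ℝ => NormedSpace.exp (Real.log (1 + x) • T)) T 0 := by
    have h := (hasDerivAt_exp_smul_const (𝕂 := ℝ) T (Real.log (1 + 0))).scomp (0 : ℝ) hlog
    simpa [Function.comp_def] using h
  have hlin : HasDerivAt (fun x : ℝ => 1 - x • T) (-T) 0 := by
    simpa using ((hasDerivAt_id (0 : ℝ)).smul_const T).const_sub 1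
  have hd : HasDerivAt (eulerTransition T) 0 0 := by
    refine (hexp.fun_mul hlin).congr_deriv ?_
    simp
  have h0 : eulerTransition T 0 = 1 := by simp [eulerTransition]
  refine isBigO_pow_succ_of_isLittleO ((analyticAt_eulerTransition T).sub analyticAt_const) ?_
  refine hd.isLittleO.congr (fun x => ?_) fun x => by rw [sub_zero, pow_one]
  simp [h0]

theorem exists_expansion_of_euler_recurrence (T : V →L[ℝ] V) {x : ℕ → V}
    (hx : ∀ n : ℕ, ((n : ℝ) + 1) • x (n + 1) = (n : ℝ) • x n - T (x n)) :
    ∃ q : ℕ → V, ∀ K, (fun n : ℕ => (n : ℝ) • NormedSpace.exp (Real.log n • T) (x n) -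
      ∑ k ∈ Finset.range K, ((n : ℝ)⁻¹) ^ k • q k) =O[atTop] fun n : ℕ => ((n : ℝ) ^ K)⁻¹ := by
  refine exists_expansion_of_difference_equation (analyticAt_eulerTransition T)
    (isBigO_eulerTransition_sub_one T) ((eventually_gt_atTop 0).mono fun n hn => ?_)
  have hn0 : (n : ℝ) ≠ 0 := by positivity
  let _ : NormedAlgebra ℚ (V →L[ℝ] V) := .restrictScalars ℚ ℝ _
  have hlog : Real.log ((n + 1 : ℕ) : ℝ) = Real.log (1 + (n : ℝ)⁻¹) + Real.log n := by
    rw [← Real.log_mul (by positivity) hn0]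
    congr 1
    push_cast
    field_simp
  have hcomm : Commute (NormedSpace.exp (Real.log n • T)) (1 - (n : ℝ)⁻¹ • T) :=
    (Commute.one_right _).sub_right (((Commute.refl T).smul_left _).exp_left.smul_right _)
  have hstep : (((n + 1 : ℕ) : ℝ)) • x (n + 1) = (1 - (n : ℝ)⁻¹ • T) ((n : ℝ) • x n) := by
    simp [hx, smul_sub, smul_smul, hn0]
  calc ((n + 1 : ℕ) : ℝ) • NormedSpace.exp (Real.log ((n + 1 : ℕ) : ℝ) • T) (x (n + 1))
      = (NormedSpace.exp (Real.log (1 + (n : ℝ)⁻¹) • T) * NormedSpace.exp (Real.log n • T))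
          (((n + 1 : ℕ) : ℝ) • x (n + 1)) := by
        rw [map_smul, hlog, add_smul, NormedSpace.exp_add_of_commute
          (((Commute.refl T).smul_left _).smul_right _)]
    _ = (NormedSpace.exp (Real.log (1 + (n : ℝ)⁻¹) • T) *
          (NormedSpace.exp (Real.log n • T) * (1 - (n : ℝ)⁻¹ • T))) ((n : ℝ) • x n) := by
        rw [hstep, ← mul_assoc]
        rfl
    _ = eulerTransition T (n : ℝ)⁻¹ ((n : ℝ) • NormedSpace.exp (Real.log n • T) (x n)) := by
        rw [hcomm.eq, ← mul_assoc, ← map_smul]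
        rfl

end EulerRecurrence

/-! ### Taylor coefficients of `(1 - z) ^ α * log (1 - z) ^ β` -/

/-- The function `(1 - z) ^ α * log (1 - z) ^ β`. -/
noncomputable def logBinom (α : ℂ) (β : ℕ) (z : ℂ) : ℂ :=
  (1 - z) ^ α * Complex.log (1 - z) ^ β

/-- The `n`-th Taylor coefficient of `(1 - z) ^ α * log (1 - z) ^ β` at the origin. -/
noncomputable def logBinomCoeff (α : ℂ) (β n : ℕ) : ℂ :=
  (n.factorial : ℂ)⁻¹ * iteratedDeriv n (logBinom α β) 0

theorem hasDerivAt_logBinom (α : ℂ) (β : ℕ) {z : ℂ} (hz : 1 - z ∈ Complex.slitPlane) :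
    HasDerivAt (logBinom α β)
      (-(α * logBinom α β z + β * logBinom α (β - 1) z) / (1 - z)) z := by
  have hsub : HasDerivAt (fun z : ℂ => 1 - z) (-1) z := (hasDerivAt_id z).const_sub 1
  have hz0 : 1 - z ≠ 0 := Complex.slitPlane_ne_zero hz
  refine ((hsub.cpow_const hz).fun_mul ((hsub.clog hz).fun_pow β)).congr_deriv ?_
  rw [Complex.cpow_sub _ _ hz0, Complex.cpow_one]
  simp only [logBinom]
  field_simp
  ring

theorem one_sub_mem_slitPlane_of_norm_lt_one {z : ℂ} (hz : ‖z‖ < 1) :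
    1 - z ∈ Complex.slitPlane := by
  simpa only [sub_eq_add_neg] using Complex.mem_slitPlane_of_norm_lt_one (z := -z) (by simpa)

theorem differentiableOn_logBinom (α : ℂ) (β : ℕ) :
    DifferentiableOn ℂ (logBinom α β) (Metric.ball 0 1) := fun _ hz =>
  (hasDerivAt_logBinom α β (one_sub_mem_slitPlane_of_norm_lt_one
    (mem_ball_zero_iff.1 hz))).differentiableAt.differentiableWithinAt

theorem analyticAt_logBinom (α : ℂ) (β : ℕ) {z : ℂ} (hz : 1 - z ∈ Complex.slitPlane) :
    AnalyticAt ℂ (logBinom α β) z :=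
  have h : AnalyticAt ℂ (fun z : ℂ => 1 - z) z := by fun_prop
  (h.cpow analyticAt_const hz).mul ((h.clog hz).pow β)

theorem hasSum_logBinomCoeff (α : ℂ) (β : ℕ) {z : ℂ} (hz : ‖z‖ < 1) :
    HasSum (fun n => logBinomCoeff α β n * z ^ n) (logBinom α β z) := by
  refine (Complex.hasSum_taylorSeries_on_ball (differentiableOn_logBinom α β)
    (mem_ball_zero_iff.2 hz)).congr_fun fun n => ?_
  simp only [logBinomCoeff, sub_zero, smul_eq_mul]
  ring

theorem iteratedDeriv_one_sub_mul {f : ℂ → ℂ} (hf : AnalyticAt ℂ f 0) (n : ℕ) :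
    iteratedDeriv n (fun z => (1 - z) * f z) 0 =
      iteratedDeriv n f 0 - n * iteratedDeriv (n - 1) f 0 := by
  rw [iteratedDeriv_fun_mul (by fun_prop) hf.contDiffAt]
  cases n with
  | zero => simp
  | succ n =>
    have hsub (i : ℕ) :
        iteratedDeriv (i + 1) (fun z : ℂ => 1 - z) 0 = if i = 0 then -1 else 0 := by
      have hderiv : deriv (fun z : ℂ => 1 - z) = fun _ => -1 := by
        funext z
        simp
      rw [iteratedDeriv_succ', hderiv, iteratedDeriv_const]
    rw [Finset.sum_range_succ', Finset.sum_range_succ']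
    simp [hsub]
    ring

theorem logBinomCoeff_succ (α : ℂ) (β n : ℕ) :
    ((n : ℂ) + 1) * logBinomCoeff α β (n + 1) =
      (n - α) * logBinomCoeff α β n - β * logBinomCoeff α (β - 1) n := by
  have han (j : ℕ) : AnalyticAt ℂ (logBinom α j) 0 := analyticAt_logBinom α j (by simp)
  have hode : (fun z => (1 - z) * deriv (logBinom α β) z) =ᶠ[𝓝 0]
      fun z => -α * logBinom α β z + -β * logBinom α (β - 1) z := by
    filter_upwards [Metric.ball_mem_nhds (0 : ℂ) one_pos] with z hz
    have hzs := one_sub_mem_slitPlane_of_norm_lt_one (mem_ball_zero_iff.1 hz)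
    rw [(hasDerivAt_logBinom α β hzs).deriv, mul_div_cancel₀ _ (Complex.slitPlane_ne_zero hzs)]
    ring
  have hn := hode.iteratedDeriv_eq n
  rw [iteratedDeriv_one_sub_mul (han β).deriv,
    iteratedDeriv_fun_add (analyticAt_const.fun_mul (han _)).contDiffAt
      (analyticAt_const.fun_mul (han _)).contDiffAt,
    iteratedDeriv_const_mul_field, iteratedDeriv_const_mul_field, ← iteratedDeriv_succ'] at hn
  have hpred : (n : ℂ) * iteratedDeriv (n - 1) (deriv (logBinom α β)) 0 =
      n * iteratedDeriv n (logBinom α β) 0 := by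
    cases n with
    | zero => simp
    | succ n => rw [iteratedDeriv_succ', Nat.add_sub_cancel]
  rw [hpred] at hn
  have hfac : (n.factorial : ℂ) ≠ 0 := Nat.cast_ne_zero.2 n.factorial_ne_zero
  have hsucc : (n : ℂ) + 1 ≠ 0 := n.cast_add_one_ne_zero
  simp only [logBinomCoeff, Nat.factorial_succ]
  push_cast
  field_simp
  linear_combination hn

/-- The matrix of the recurrence `logBinomCoeff_succ`: the vector `(logBinomCoeff α j n)_j` is sent
by `α + logBinomShift β` to `(α * logBinomCoeff α j n + j * logBinomCoeff α (j - 1) n)_j`. -/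
noncomputable def logBinomShift (β : ℕ) : (Fin (β + 1) → ℂ) →L[ℝ] (Fin (β + 1) → ℂ) :=
  ContinuousLinearMap.pi fun j => (j : ℝ) • ContinuousLinearMap.proj (j - 1)

theorem logBinomShift_apply (β : ℕ) (v : Fin (β + 1) → ℂ) (j : Fin (β + 1)) :
    logBinomShift β v j = (j : ℂ) * v (j - 1) := by
  simp [logBinomShift]

theorem logBinomShift_pow_eq_zero (β : ℕ) : logBinomShift β ^ (β + 1) = 0 := by
  have hlow (i : ℕ) (v : Fin (β + 1) → ℂ) (j : Fin (β + 1)) (hj : j.val < i) :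
      (logBinomShift β ^ i) v j = 0 := by
    induction i generalizing v j with
    | zero => omega
    | succ i ih =>
      rw [pow_succ', mul_apply_eq_comp, logBinomShift_apply]
      rcases eq_or_ne j 0 with rfl | hj0
      · simp
      · have hval : (j - 1).val = j.val - 1 := Fin.val_sub_one_of_ne_zero hj0
        have : j.val ≠ 0 := Fin.val_ne_zero_iff.2 hj0
        rw [ih _ _ (by omega), mul_zero]
  ext v j
  exact hlow _ v j j.isLt

theorem exp_smul_smul_one_add_of_pow_eq_zero {𝔸 : Type*} [NormedRing 𝔸] [NormedAlgebra ℝ 𝔸]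
    [CompleteSpace 𝔸] {N : 𝔸} {m : ℕ} (hN : N ^ m = 0) (a t : ℝ) :
    NormedSpace.exp (t • (a • 1 + N)) =
      Real.exp (t * a) • ∑ j ∈ Finset.range m, (t ^ j / j.factorial) • N ^ j := by
  let _ : NormedAlgebra ℚ 𝔸 := .restrictScalars ℚ ℝ 𝔸
  have hexpN : NormedSpace.exp (t • N) = ∑ j ∈ Finset.range m, (t ^ j / j.factorial) • N ^ j := by
    rw [NormedSpace.exp_eq_tsum ℝ]
    refine (tsum_eq_sum fun j hj => ?_).trans (Finset.sum_congr rfl fun j _ => ?_)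
    · rw [smul_pow, pow_eq_zero_of_le (not_lt.1 (Finset.mem_range.not.1 hj)) hN, smul_zero,
        smul_zero]
    · rw [smul_pow, smul_smul, div_eq_inv_mul]
  have hcomm : Commute ((t * a) • (1 : 𝔸)) (t • N) :=
    ((Commute.one_left N).smul_left _).smul_right _
  rw [smul_add, smul_smul, NormedSpace.exp_add_of_commute hcomm, hexpN,
    ← Algebra.algebraMap_eq_smul_one, ← NormedSpace.algebraMap_exp_comm,
    Algebra.algebraMap_eq_smul_one, smul_one_mul, Real.exp_eq_exp_ℝ]

theorem nilssonMonomial_add_natCast (α : ℚ) (k j : ℕ) {n : ℕ} (hn : 0 < n) :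
    nilssonMonomial (α + k, j) n = nilssonMonomial (α, j) n * (n : ℝ)⁻¹ ^ k := by
  have hn0 : (0 : ℝ) < n := Nat.cast_pos.2 hn
  simp only [nilssonMonomial]
  push_cast
  rw [Real.rpow_add hn0, Real.rpow_natCast, inv_pow, div_mul_eq_div_mul_one_div, one_div]

theorem isBigO_nilssonMonomial_of_le (α : ℚ) {j β : ℕ} (hj : j ≤ β) :
    nilssonMonomial (α, j) =O[atTop] nilssonMonomial (α, β) := by
  refine .of_bound 1 ?_
  filter_upwards [(Real.tendsto_log_atTop.comp tendsto_natCast_atTop_atTop).eventually_ge_atTop 1]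
    with n hn
  simp only [Function.comp_apply] at hn
  simp only [nilssonMonomial, norm_div, norm_pow, one_mul,
    Real.norm_of_nonneg (zero_le_one.trans hn)]
  gcongr

theorem isBigO_sub_sum_nilssonMonomial {α : ℚ} {β K : ℕ} {u : ℕ → ℂ} {y : ℕ → ℕ → ℂ}
    {e : ℕ → ℕ → ℂ}
    (hu : ∀ᶠ n in atTop, u n = ∑ j ∈ Finset.range (β + 1), (nilssonMonomial (α, j) n : ℂ) * y j n)
    (hy : ∀ j, (fun n : ℕ => y j n - ∑ k ∈ Finset.range K, (n : ℂ)⁻¹ ^ k * e k j) =O[atTop]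
      fun n : ℕ => ((n : ℝ) ^ K)⁻¹) :
    (fun n => u n - ∑ k ∈ Finset.range K, ∑ j ∈ Finset.range (β + 1),
      (nilssonMonomial (α + k, j) n : ℂ) * e k j) =O[atTop] nilssonMonomial (α + K, β) := by
  have hterm : ∀ j ∈ Finset.range (β + 1), (fun n : ℕ => (nilssonMonomial (α, j) n : ℂ) *
      (y j n - ∑ k ∈ Finset.range K, (n : ℂ)⁻¹ ^ k * e k j)) =O[atTop]
      nilssonMonomial (α + K, β) := by
    intro j hj
    have hmono := isBigO_nilssonMonomial_of_le α (Nat.lt_succ_iff.1 (Finset.mem_range.1 hj))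
    refine ((Complex.isBigO_ofReal_left.2 hmono).mul (hy j)).congr' .rfl ?_
    filter_upwards [eventually_gt_atTop 0] with n hn
    rw [nilssonMonomial_add_natCast α K β hn, inv_pow]
  refine (Asymptotics.IsBigO.fun_sum hterm).congr' ?_ .rfl
  filter_upwards [hu, eventually_gt_atTop 0] with n hn hn0
  rw [hn, Finset.sum_comm, ← Finset.sum_sub_distrib]
  refine Finset.sum_congr rfl fun j _ => ?_
  rw [mul_sub, Finset.mul_sum]
  refine congrArg _ (Finset.sum_congr rfl fun k _ => ?_)
  rw [nilssonMonomial_add_natCast α k j hn0]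
  push_cast
  ring

/-- The operator `α + N` of the Euler recurrence of the vectors `(logBinomCoeff α j n)_{j ≤ β}`. -/
noncomputable def logBinomOp (α : ℝ) (β : ℕ) : (Fin (β + 1) → ℂ) →L[ℝ] (Fin (β + 1) → ℂ) :=
  α • 1 + logBinomShift β

theorem logBinomCoeff_euler_recurrence (α : ℝ) (β n : ℕ) :
    ((n : ℝ) + 1) • (fun j : Fin (β + 1) => logBinomCoeff α j (n + 1)) =
      (n : ℝ) • (fun j : Fin (β + 1) => logBinomCoeff α j n) -
        logBinomOp α β fun j : Fin (β + 1) => logBinomCoeff α j n := by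
  ext j
  have hprev : (j : ℂ) * logBinomCoeff α (j - 1 : Fin (β + 1)) n =
      j * logBinomCoeff α (j - 1 : ℕ) n := by
    rcases eq_or_ne j 0 with rfl | hj0
    · simp
    · rw [Fin.val_sub_one_of_ne_zero hj0]
  have h := logBinomCoeff_succ α j n
  simp only [Pi.smul_apply, Pi.sub_apply, Pi.add_apply, add_apply, smul_apply, one_apply_eq_self,
    logBinomOp, logBinomShift_apply, hprev, Complex.real_smul]
  push_cast
  linear_combination h

/-- The coefficient of `t ^ j` in the last coordinate of `exp (-t • logBinomShift β)`. -/
noncomputable def logBinomProj (β j : ℕ) : (Fin (β + 1) → ℂ) →L[ℝ] ℂ :=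
  ((-1 : ℝ) ^ j / j.factorial) •
    (ContinuousLinearMap.proj (Fin.last β)).comp (logBinomShift β ^ j)

theorem exp_neg_smul_logBinomOp_last (α t : ℝ) (β : ℕ) (v : Fin (β + 1) → ℂ) :
    NormedSpace.exp (-t • logBinomOp α β) v (Fin.last β) =
      ∑ j ∈ Finset.range (β + 1), ((Real.exp (-t * α) * t ^ j : ℝ) : ℂ) * logBinomProj β j v := by
  rw [logBinomOp, exp_smul_smul_one_add_of_pow_eq_zero (logBinomShift_pow_eq_zero β)]
  simp only [logBinomProj, smul_apply, sum_apply, Pi.smul_apply, Finset.sum_apply,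
    Finset.smul_sum, Complex.real_smul, ContinuousLinearMap.comp_apply,
    ContinuousLinearMap.proj_apply]
  refine Finset.sum_congr rfl fun j _ => ?_
  rw [neg_pow]
  push_cast
  ring

theorem nilssonMonomial_add_one_eq_exp (α : ℚ) (j : ℕ) {n : ℕ} (hn : 0 < n) :
    nilssonMonomial (α + 1, j) n = Real.exp (-Real.log n * α) * Real.log n ^ j * (n : ℝ)⁻¹ := by
  have h := nilssonMonomial_add_natCast α 1 j hn
  rw [Nat.cast_one, pow_one] at h
  rw [h, nilssonMonomial, Real.rpow_def_of_pos (Nat.cast_pos.2 hn), neg_mul, Real.exp_neg]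
  ring

theorem exp_neg_smul_apply_exp_smul_apply {V : Type*} [NormedAddCommGroup V] [NormedSpace ℝ V]
    [CompleteSpace V] (T : V →L[ℝ] V) (t : ℝ) (v : V) :
    NormedSpace.exp (-t • T) (NormedSpace.exp (t • T) v) = v := by
  let _ : NormedAlgebra ℚ (V →L[ℝ] V) := .restrictScalars ℚ ℝ _
  have h : NormedSpace.exp (-t • T) * NormedSpace.exp (t • T) = 1 := by
    rw [← NormedSpace.exp_add_of_commute (((Commute.refl T).smul_left _).smul_right _), neg_smul,
      neg_add_cancel, NormedSpace.exp_zero]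
  exact DFunLike.congr_fun h v

theorem apply_last_eq_sum_nilssonMonomial (α : ℚ) (β : ℕ) {n : ℕ} (hn : 0 < n)
    (v : Fin (β + 1) → ℂ) :
    v (Fin.last β) = ∑ j ∈ Finset.range (β + 1), (nilssonMonomial (α + 1, j) n : ℂ) *
      logBinomProj β j ((n : ℝ) • NormedSpace.exp (Real.log n • logBinomOp α β) v) := by
  have hn0 : (n : ℂ) ≠ 0 := Nat.cast_ne_zero.2 hn.ne'
  nth_rewrite 1 [← exp_neg_smul_apply_exp_smul_apply (logBinomOp α β) (Real.log n) v]
  rw [exp_neg_smul_logBinomOp_last]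
  refine Finset.sum_congr rfl fun j _ => ?_
  rw [nilssonMonomial_add_one_eq_exp α j hn, map_smul, Complex.real_smul]
  push_cast
  field_simp

theorem exists_expansion_logBinomCoeff (α : ℚ) (β : ℕ) :
    ∃ e : ℕ → ℕ → ℂ, ∀ K : ℕ,
      (fun n : ℕ => logBinomCoeff α β n -
        ∑ k ∈ Finset.range K, ∑ j ∈ Finset.range (β + 1),
          (nilssonMonomial (α + 1 + k, j) n : ℂ) * e k j) =O[atTop]
      nilssonMonomial (α + 1 + K, β) := by
  let x (n : ℕ) (j : Fin (β + 1)) : ℂ := logBinomCoeff α j n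
  obtain ⟨q, hq⟩ := exists_expansion_of_euler_recurrence (logBinomOp α β) (x := x) fun n =>
    logBinomCoeff_euler_recurrence α β n
  refine ⟨fun k j => logBinomProj β j (q k), fun K => isBigO_sub_sum_nilssonMonomial
    ((eventually_gt_atTop 0).mono fun n hn => apply_last_eq_sum_nilssonMonomial α β hn (x n))
    fun j => ?_⟩
  refine (((logBinomProj β j).isBigO_comp _ _).trans (hq K)).congr_left fun n => ?_
  simp only [map_sub, map_sum, map_smul, Complex.real_smul]
  push_cast
  rfl

/-! ### Nilsson expansions -/

theorem mem_nilssonSegment {S : Finset ℚ} {d : ℕ} {ω ω' : ℚ × ℕ} :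
    ω' ∈ nilssonSegment S d ω ↔ ω' ∈ nilssonIndex S d ∧ nilssonLE ω' ω := by
  simp [nilssonSegment]

theorem mem_nilssonSegment_natCast {S : Finset ℚ} {d J : ℕ} {ω : ℚ × ℕ} :
    ω ∈ nilssonSegment S d (J, 0) ↔ ω ∈ nilssonIndex S d ∧ ω.1 ≤ J := by
  have h : nilssonLE ω (J, 0) ↔ ω.1 ≤ J := by
    simpa only [nilssonLE, Nat.zero_le, and_true] using le_iff_lt_or_eq.symm
  rw [mem_nilssonSegment, h]

theorem nilssonIndex_mono {S S' : Finset ℚ} (hS : S ⊆ S') {d d' : ℕ} (hd : d ≤ d') :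
    nilssonIndex S d ⊆ nilssonIndex S' d' := by
  rintro ω ⟨⟨s, hs, k, hk⟩, hω⟩
  exact ⟨⟨s, hS hs, k, hk⟩, hω.trans hd⟩

theorem nilssonMonomial_natCast_zero (J : ℕ) :
    nilssonMonomial (J, 0) = fun n : ℕ => ((n : ℝ) ^ J)⁻¹ := by
  funext n
  simp [nilssonMonomial]

theorem isLittleO_nilssonMonomial_of_fst_lt {ω ω' : ℚ × ℕ} (h : ω.1 < ω'.1) :
    nilssonMonomial ω' =o[atTop] nilssonMonomial ω := by
  have hpos : 0 < (ω'.1 : ℝ) - ω.1 := sub_pos.2 (Rat.cast_lt.2 h)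
  have hpow : (fun n : ℕ => Real.log n ^ ω'.2) =o[atTop] fun n : ℕ =>
      (n : ℝ) ^ ((ω'.1 : ℝ) - ω.1) := by
    simpa [Function.comp_def] using
      (isLittleO_log_rpow_rpow_atTop (ω'.2 : ℝ) hpos).comp_tendsto tendsto_natCast_atTop_atTop
  have hlog : (fun n : ℕ => ((n : ℝ) ^ (ω.1 : ℝ))⁻¹) =O[atTop] nilssonMonomial ω := by
    refine (isBigO_nilssonMonomial_of_le ω.1 ω.2.zero_le).congr_left fun n => ?_
    simp only [nilssonMonomial, pow_zero, one_div]
  refine ((hpow.mul_isBigO (Asymptotics.isBigO_refl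
    (fun n : ℕ => ((n : ℝ) ^ (ω'.1 : ℝ))⁻¹) atTop)).congr' .rfl ?_).trans_isBigO hlog
  filter_upwards [eventually_gt_atTop 0] with n hn
  have hn0 : (0 : ℝ) < n := Nat.cast_pos.2 hn
  have hne := (Real.rpow_pos_of_pos hn0 (ω'.1 : ℝ)).ne'
  rw [Real.rpow_sub hn0, div_eq_mul_inv, mul_right_comm, mul_inv_cancel₀ hne, one_mul]

theorem isLittleO_nilssonMonomial_of_snd_lt (α : ℚ) {j β : ℕ} (h : j < β) :
    nilssonMonomial (α, j) =o[atTop] nilssonMonomial (α, β) :=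
  (((Asymptotics.isLittleO_pow_pow_atTop_of_lt (𝕜 := ℝ) h).comp_tendsto
    (Real.tendsto_log_atTop.comp tendsto_natCast_atTop_atTop)).mul_isBigO
      (Asymptotics.isBigO_refl (fun n : ℕ => ((n : ℝ) ^ (α : ℝ))⁻¹) atTop))

theorem isLittleO_nilssonMonomial {ω ω' : ℚ × ℕ} (h : ¬ nilssonLE ω' ω) :
    nilssonMonomial ω' =o[atTop] nilssonMonomial ω := by
  simp only [nilssonLE, not_or, not_lt, not_and, not_le] at h
  rcases h.1.lt_or_eq with hlt | heq
  · exact isLittleO_nilssonMonomial_of_fst_lt hlt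
  · obtain ⟨α, β⟩ := ω
    obtain ⟨α', β'⟩ := ω'
    obtain rfl : α = α' := heq
    exact isLittleO_nilssonMonomial_of_snd_lt α (h.2 rfl)

theorem isBigO_nilssonMonomial_inv_pow {J : ℕ} {ω : ℚ × ℕ} (h : (J : ℚ) < ω.1) :
    (fun n => (nilssonMonomial ω n : ℂ)) =O[atTop] fun n : ℕ => ((n : ℝ) ^ J)⁻¹ := by
  rw [← nilssonMonomial_natCast_zero, Complex.isBigO_ofReal_left]
  exact (isLittleO_nilssonMonomial_of_fst_lt (ω := (J, 0)) h).isBigO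

section NilssonExpansion

/-- The sequence `u` is `∑ h_ω(n) c_ω` up to an error `O(n ^ (-J))`. The sum ranges over some finite
set that contains all terms which are not themselves covered by the error. -/
def HasNilssonExpansionTo (J : ℕ) (u : ℕ → ℂ) (c : ℚ × ℕ → ℂ) : Prop :=
  ∃ P : Finset (ℚ × ℕ), (∀ ω ∉ P, c ω ≠ 0 → (J : ℚ) < ω.1) ∧
    (fun n => u n - ∑ ω ∈ P, (nilssonMonomial ω n : ℂ) * c ω) =O[atTop]
      fun n : ℕ => ((n : ℝ) ^ J)⁻¹

variable {J : ℕ} {u : ℕ → ℂ} {c : ℚ × ℕ → ℂ}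

theorem isBigO_sum_nilssonMonomial {P : Finset (ℚ × ℕ)}
    (hP : ∀ ω ∈ P, c ω ≠ 0 → (J : ℚ) < ω.1) :
    (fun n => ∑ ω ∈ P, (nilssonMonomial ω n : ℂ) * c ω) =O[atTop]
      fun n : ℕ => ((n : ℝ) ^ J)⁻¹ := by
  refine .fun_sum fun ω hω => ?_
  rcases eq_or_ne (c ω) 0 with h0 | h0
  · simpa only [h0, mul_zero] using Asymptotics.isBigO_zero _ _
  · simpa only [mul_comm] using (isBigO_nilssonMonomial_inv_pow (hP ω hω h0)).const_mul_left (c ω)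

theorem HasNilssonExpansionTo.isBigO_sub_sum (h : HasNilssonExpansionTo J u c)
    {P : Finset (ℚ × ℕ)} (hP : ∀ ω ∉ P, c ω ≠ 0 → (J : ℚ) < ω.1) :
    (fun n => u n - ∑ ω ∈ P, (nilssonMonomial ω n : ℂ) * c ω) =O[atTop]
      fun n : ℕ => ((n : ℝ) ^ J)⁻¹ := by
  obtain ⟨Q, hQ, hu⟩ := h
  have hQP := isBigO_sum_nilssonMonomial (P := Q \ P) fun ω hω => hP ω (Finset.mem_sdiff.1 hω).2
  have hPQ := isBigO_sum_nilssonMonomial (P := P \ Q) fun ω hω => hQ ω (Finset.mem_sdiff.1 hω).2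
  refine ((hu.add hQP).sub hPQ).congr_left fun n => ?_
  linear_combination -Finset.sum_sdiff_sub_sum_sdiff (s₁ := Q) (s₂ := P)
    (f := fun ω => (nilssonMonomial ω n : ℂ) * c ω)

theorem HasNilssonExpansionTo.congr_coeff (h : HasNilssonExpansionTo J u c) {c' : ℚ × ℕ → ℂ}
    (hc : ∀ ω : ℚ × ℕ, ω.1 ≤ J → c ω = c' ω) : HasNilssonExpansionTo J u c' := by
  obtain ⟨P, hP, -⟩ := id h
  let Q := P.filter fun ω : ℚ × ℕ => ω.1 ≤ J
  have hQ : ∀ ω ∉ Q, c ω ≠ 0 → (J : ℚ) < ω.1 := fun ω hω h0 => by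
    by_contra! hle
    exact hω (Finset.mem_filter.2 ⟨by_contra fun hn => (hP ω hn h0).not_ge hle, hle⟩)
  refine ⟨Q, fun ω hω h0 => ?_, (h.isBigO_sub_sum hQ).congr_left fun n => ?_⟩
  · by_contra! hle
    exact (hQ ω hω (hc ω hle ▸ h0)).not_ge hle
  · refine congrArg _ (Finset.sum_congr rfl fun ω hω => ?_)
    rw [hc ω (Finset.mem_filter.1 hω).2]

theorem HasNilssonExpansionTo.const_mul (h : HasNilssonExpansionTo J u c) (a : ℂ) :
    HasNilssonExpansionTo J (fun n => a * u n) fun ω => a * c ω := by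
  obtain ⟨P, hP, hu⟩ := h
  refine ⟨P, fun ω hω h0 => hP ω hω (right_ne_zero_of_mul h0),
    (hu.const_mul_left a).congr_left fun n => ?_⟩
  rw [mul_sub, Finset.mul_sum]
  simp only [mul_left_comm a]

theorem HasNilssonExpansionTo.sum {ι : Type*} {s : Finset ι} {u : ι → ℕ → ℂ} {c : ι → ℚ × ℕ → ℂ}
    (h : ∀ i ∈ s, HasNilssonExpansionTo J (u i) (c i)) :
    HasNilssonExpansionTo J (fun n => ∑ i ∈ s, u i n) fun ω => ∑ i ∈ s, c i ω := by
  classical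
  choose! P hP _ using id h
  have hP' : ∀ i ∈ s, ∀ ω ∉ s.biUnion P, c i ω ≠ 0 → (J : ℚ) < ω.1 := fun i hi ω hω =>
    hP i hi ω fun hmem => hω (Finset.mem_biUnion.2 ⟨i, hi, hmem⟩)
  refine ⟨s.biUnion P, fun ω hω h0 => ?_, ?_⟩
  · obtain ⟨i, hi, h0⟩ := Finset.exists_ne_zero_of_sum_ne_zero h0
    exact hP' i hi ω hω h0
  · refine (Asymptotics.IsBigO.fun_sum fun i hi =>
      (h i hi).isBigO_sub_sum (hP' i hi)).congr_left fun n => ?_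
    simp only [Finset.sum_sub_distrib, Finset.mul_sum]
    rw [Finset.sum_comm]

theorem exists_hasNilssonExpansionTo_logBinomCoeff (α : ℚ) (β : ℕ) :
    ∃ c : ℚ × ℕ → ℂ, (∀ ω, c ω ≠ 0 → ∃ k : ℕ, ω.1 = α + 1 + k ∧ ω.2 ≤ β) ∧
      ∀ J, HasNilssonExpansionTo J (logBinomCoeff α β) c := by
  obtain ⟨e, he⟩ := exists_expansion_logBinomCoeff α β
  let φ (i : ℕ × ℕ) : ℚ × ℕ := (α + 1 + i.1, i.2)
  have hφ : Function.Injective φ := fun i j h => by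
    simp only [φ, Prod.mk.injEq, add_right_inj, Nat.cast_inj] at h
    exact Prod.ext h.1 h.2
  let c : ℚ × ℕ → ℂ := Function.extend φ (fun i => if i.2 ≤ β then e i.1 i.2 else 0) 0
  have hcφ (i : ℕ × ℕ) : c (φ i) = if i.2 ≤ β then e i.1 i.2 else 0 := hφ.extend_apply _ _ i
  have hc : ∀ ω, c ω ≠ 0 → ∃ i : ℕ × ℕ, i.2 ≤ β ∧ φ i = ω := fun ω h0 => by
    obtain ⟨i, rfl⟩ : ∃ i, φ i = ω := by
      by_contra hω
      exact h0 (Function.extend_apply' _ _ _ hω)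
    exact ⟨i, by_contra fun hi => h0 ((hcφ i).trans (if_neg hi)), rfl⟩
  refine ⟨c, fun ω h0 => ?_, fun J => ?_⟩
  · obtain ⟨i, hi, rfl⟩ := hc ω h0
    exact ⟨i.1, rfl, hi⟩
  obtain ⟨K, hK⟩ := exists_nat_gt ((J : ℚ) - α - 1)
  refine ⟨(Finset.range K ×ˢ Finset.range (β + 1)).image φ, fun ω hω h0 => ?_, ?_⟩
  · obtain ⟨i, hi, rfl⟩ := hc ω h0
    have hKi : K ≤ i.1 := by
      by_contra! hlt
      exact hω (Finset.mem_image_of_mem φ (Finset.mem_product.2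
        ⟨Finset.mem_range.2 hlt, Finset.mem_range.2 (Nat.lt_succ_of_le hi)⟩))
    have : (K : ℚ) ≤ i.1 := Nat.cast_le.2 hKi
    simp only [φ]
    linarith
  · have hJK : (J : ℚ) < α + 1 + K := by linarith
    refine ((he K).trans (Complex.isBigO_ofReal_left.1
      (isBigO_nilssonMonomial_inv_pow (ω := (α + 1 + K, β)) hJK))).congr_left fun n => ?_
    rw [Finset.sum_image hφ.injOn, Finset.sum_product]
    refine congrArg _ (Finset.sum_congr rfl fun k _ => Finset.sum_congr rfl fun j hj => ?_)
    rw [hcφ, if_pos (Nat.lt_succ_iff.1 (Finset.mem_range.1 hj))]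

end NilssonExpansion

/-- A formal series `∑ γ_{k, β} x ^ (k / m - N) (log x) ^ β`, over `k ∈ ℕ` and `β ≤ ν`. -/
structure LogPuiseuxSeries where
  ramification : ℕ
  ramification_pos : 0 < ramification
  poleOrder : ℕ
  logDegree : ℕ
  coeff : ℕ → ℕ → ℂ

namespace LogPuiseuxSeries

instance : Inhabited LogPuiseuxSeries := ⟨1, one_pos, 0, 0, 0⟩

/-- The exponent `k / m - N` of the `k`-th terms of a log-Puiseux series. -/
def exponent (F : LogPuiseuxSeries) (k : ℕ) : ℚ :=
  (k : ℚ) / F.ramification - F.poleOrder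

/-- The sum of the terms `k < K` of a log-Puiseux series at `x = 1 - z`. -/
noncomputable def partialSum (F : LogPuiseuxSeries) (K : ℕ) (z : ℂ) : ℂ :=
  ∑ k ∈ Finset.range K, ∑ β ∈ Finset.range (F.logDegree + 1),
    F.coeff k β * logBinom (F.exponent k : ℂ) β z

/-- The `n`-th Taylor coefficient of `F.partialSum K` at `0`. -/
noncomputable def partialSumCoeff (F : LogPuiseuxSeries) (K n : ℕ) : ℂ :=
  ∑ k ∈ Finset.range K, ∑ β ∈ Finset.range (F.logDegree + 1),
    F.coeff k β * logBinomCoeff (F.exponent k : ℂ) β n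

variable (F : LogPuiseuxSeries)

theorem hasSum_partialSumCoeff (K : ℕ) {z : ℂ} (hz : ‖z‖ < 1) :
    HasSum (fun n => F.partialSumCoeff K n * z ^ n) (F.partialSum K z) := by
  simp only [partialSumCoeff, partialSum, Finset.sum_mul, mul_assoc]
  exact hasSum_sum fun k _ => hasSum_sum fun β _ => (hasSum_logBinomCoeff _ β hz).mul_left _

theorem analyticAt_partialSum (K : ℕ) {z : ℂ} (hz : 1 - z ∈ Complex.slitPlane) :
    AnalyticAt ℂ (F.partialSum K) z :=
  Finset.analyticAt_fun_sum _ fun _ _ => Finset.analyticAt_fun_sum _ fun β _ =>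
    analyticAt_const.mul (analyticAt_logBinom _ β hz)

theorem lt_of_exponent_lt {k : ℕ} {α : ℚ} (h : F.exponent k < α) :
    k < ⌈(α + F.poleOrder) * F.ramification⌉₊ := by
  rw [exponent, sub_lt_iff_lt_add, div_lt_iff₀ (Nat.cast_pos.2 F.ramification_pos)] at h
  exact Nat.lt_ceil.2 h

/-- Representatives modulo `1` of the exponents of a log-Puiseux series. -/
def exponentSet : Finset ℚ :=
  (Finset.range F.ramification).image F.exponent

theorem exists_exponent_eq_add (k : ℕ) : ∃ s ∈ F.exponentSet, ∃ i : ℕ, F.exponent k = s + i := by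
  have hm : (F.ramification : ℚ) ≠ 0 := Nat.cast_ne_zero.2 F.ramification_pos.ne'
  refine ⟨F.exponent (k % F.ramification), Finset.mem_image_of_mem _
    (Finset.mem_range.2 (Nat.mod_lt _ F.ramification_pos)), k / F.ramification, ?_⟩
  have hk : (k : ℚ) = (k % F.ramification : ℕ) + F.ramification * (k / F.ramification : ℕ) := by
    exact_mod_cast (Nat.mod_add_div k F.ramification).symm
  rw [exponent, exponent, hk]
  field_simp
  ring

theorem exists_hasNilssonExpansionTo_partialSumCoeff :
    ∃ (S : Finset ℚ) (d : ℕ) (c : ℚ × ℕ → ℂ), (∀ ω, c ω ≠ 0 → ω ∈ nilssonIndex S d) ∧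
      ∀ J : ℕ, ∀ᶠ K in atTop, HasNilssonExpansionTo J (F.partialSumCoeff K) c := by
  choose E hE hexp using fun k β => exists_hasNilssonExpansionTo_logBinomCoeff (F.exponent k) β
  let κ (α : ℚ) : ℕ := ⌈(α + F.poleOrder) * F.ramification⌉₊
  have hκ : ∀ k β ω, κ ω.1 ≤ k → E k β ω = 0 := fun k β ω hk => by
    by_contra h0
    obtain ⟨i, hi, -⟩ := hE k β ω h0
    exact hk.not_gt (F.lt_of_exponent_lt (by linarith [i.cast_nonneg (α := ℚ)]))
  refine ⟨F.exponentSet, F.logDegree,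
    fun ω => ∑ k ∈ Finset.range (κ ω.1), ∑ β ∈ Finset.range (F.logDegree + 1),
      F.coeff k β * E k β ω,
    fun ω h0 => ?_, fun J => eventually_atTop.2 ⟨κ J, fun K hK => ?_⟩⟩
  · obtain ⟨k, -, h0⟩ := Finset.exists_ne_zero_of_sum_ne_zero h0
    obtain ⟨β, hβ, h0⟩ := Finset.exists_ne_zero_of_sum_ne_zero h0
    obtain ⟨i, hi, hj⟩ := hE k β ω (right_ne_zero_of_mul h0)
    obtain ⟨s, hs, l, hl⟩ := F.exists_exponent_eq_add k
    refine ⟨⟨s, hs, l + 1 + i, ?_⟩, hj.trans (Nat.lt_succ_iff.1 (Finset.mem_range.1 hβ))⟩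
    rw [hi, hl]
    push_cast
    ring
  · refine (HasNilssonExpansionTo.sum fun k _ => HasNilssonExpansionTo.sum fun β _ =>
      (hexp k β J).const_mul (F.coeff k β)).congr_coeff fun ω hω => ?_
    have hle : κ ω.1 ≤ K := le_trans (Nat.ceil_le_ceil (by gcongr)) hK
    refine (Finset.sum_subset (Finset.range_subset_range.2 hle) fun k _ hk => ?_).symm
    refine Finset.sum_eq_zero fun β _ => ?_
    rw [hκ k β ω (not_lt.1 (Finset.mem_range.not.1 hk)), mul_zero]

end LogPuiseuxSeries

section NilssonType

variable {a : ℕ → ℂ} {S : Finset ℚ} {d : ℕ} {L : Finset ℂ}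

theorem isBigO_one_sum_mul_pow {ι : Type*} {s : Finset ι} {q : ι → ℂ} (hq : ∀ i ∈ s, ‖q i‖ ≤ 1)
    (c : ι → ℂ) : (fun n : ℕ => ∑ i ∈ s, c i * q i ^ n) =O[atTop] fun _ => (1 : ℝ) := by
  refine .fun_sum fun i hi => .of_bound ‖c i‖ (.of_forall fun n => ?_)
  rw [norm_mul, norm_pow, norm_one]
  gcongr
  exact pow_le_one₀ (norm_nonneg _) (hq i hi)

theorem tendsto_div_nilssonMonomial {u : ℕ → ℂ} {s : ℚ × ℕ → ℕ → ℂ}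
    (hs : ∀ ω, s ω =O[atTop] fun _ => (1 : ℝ))
    (hu : ∀ J : ℕ, (fun n => u n - ∑ ω ∈ nilssonSegment S d (J, 0),
      (nilssonMonomial ω n : ℂ) * s ω n) =O[atTop] fun n : ℕ => ((n : ℝ) ^ J)⁻¹) (ω : ℚ × ℕ) :
    Tendsto (fun n => (u n - ∑ ω' ∈ nilssonSegment S d ω, (nilssonMonomial ω' n : ℂ) * s ω' n) /
      (nilssonMonomial ω n : ℂ)) atTop (𝓝 0) := by
  obtain ⟨J, hJ⟩ := exists_nat_gt ω.1
  have hrem : (fun n => u n - ∑ ω ∈ nilssonSegment S d (J, 0), (nilssonMonomial ω n : ℂ) * s ω n)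
      =o[atTop] nilssonMonomial ω := by
    refine (hu J).trans_isLittleO ?_
    rw [← nilssonMonomial_natCast_zero]
    exact isLittleO_nilssonMonomial_of_fst_lt hJ
  have hsub : nilssonSegment S d ω ⊆ nilssonSegment S d (J, 0) := fun ω' hω' => by
    obtain ⟨hmem, hle⟩ := mem_nilssonSegment.1 hω'
    exact mem_nilssonSegment_natCast.2 ⟨hmem, (hle.elim le_of_lt fun h => h.1.le).trans hJ.le⟩
  have hmid : (fun n => ∑ ω' ∈ nilssonSegment S d (J, 0) \ nilssonSegment S d ω,
      (nilssonMonomial ω' n : ℂ) * s ω' n) =o[atTop] nilssonMonomial ω := by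
    refine .fun_sum fun ω' hω' => ?_
    rw [Finset.mem_sdiff, mem_nilssonSegment_natCast, mem_nilssonSegment] at hω'
    have hlt := isLittleO_nilssonMonomial fun hle => hω'.2 ⟨hω'.1.1, hle⟩
    simpa only [mul_one] using (Complex.isLittleO_ofReal_left.2 hlt).mul_isBigO (hs ω')
  refine (Complex.isLittleO_ofReal_right.2 (hrem.add hmid)).tendsto_div_nhds_zero.congr fun n => ?_
  rw [← Finset.sum_sdiff hsub]
  ring

theorem isNilssonType_of_isBigO {r : ℝ} (hr : 0 < r) (hL : ∀ p ∈ L, ‖p‖ = r)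
    {c : ℚ × ℕ → ℂ → ℂ}
    (ha : ∀ J : ℕ, (fun n => a n * (r : ℂ) ^ n - ∑ ω ∈ nilssonSegment S d (J, 0),
      (nilssonMonomial ω n : ℂ) * ∑ p ∈ L, c ω p * (r / p) ^ n) =O[atTop]
        fun n : ℕ => ((n : ℝ) ^ J)⁻¹)
    (hc : ∃ ω ∈ nilssonIndex S d, ∃ p ∈ L, c ω p ≠ 0) : IsNilssonType a := by
  have hsum (ω : ℚ × ℕ) (n : ℕ) : ∑ l ∈ L.image (·⁻¹), c ω l⁻¹ * (l / (r⁻¹ : ℝ)) ^ n =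
      ∑ p ∈ L, c ω p * (r / p) ^ n := by
    rw [Finset.sum_image inv_injective.injOn]
    refine Finset.sum_congr rfl fun p _ => ?_
    rw [inv_inv, Complex.ofReal_inv, div_inv_eq_mul, inv_mul_eq_div]
  have hnorm : ∀ l ∈ L.image (·⁻¹), ‖l‖ = r⁻¹ := by
    intro l hl
    obtain ⟨p, hp, rfl⟩ := Finset.mem_image.1 hl
    rw [norm_inv, hL p hp]
  refine ⟨S, d, r⁻¹, L.image (·⁻¹), fun ω l => c ω l⁻¹, inv_pos.2 hr, hnorm, fun ω _ => ?_, ?_⟩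
  · simp only [hsum]
    refine tendsto_div_nilssonMonomial
      (fun ω => isBigO_one_sum_mul_pow (fun p hp => ?_) (c ω)) (fun J => ?_) ω
    · rw [norm_div, hL p hp, Complex.norm_of_nonneg hr.le, div_self hr.ne']
    · refine (ha J).congr_left fun n => ?_
      rw [Complex.ofReal_inv, inv_pow, div_inv_eq_mul]
  · obtain ⟨ω, hω, p, hp, h0⟩ := hc
    exact ⟨ω, hω, p⁻¹, Finset.mem_image_of_mem _ hp, by simpa only [inv_inv] using h0⟩

end NilssonType

/-! ### Log-Puiseux form of a function with quasi-unipotent monodromy -/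

theorem exists_pow_sub_one_pow_eq_zero {V : Type*} [AddCommGroup V] [Module ℂ V]
    [FiniteDimensional ℂ V] (T : Module.End ℂ V)
    (h : ∀ μ : ℂ, T.HasEigenvalue μ → ∃ m : ℕ, 0 < m ∧ μ ^ m = 1) :
    ∃ m ν : ℕ, 0 < m ∧ (T ^ m - 1) ^ (ν + 1) = 0 := by
  have hroot : ∀ μ ∈ T.charpoly.roots, ∃ m : ℕ, 0 < m ∧ μ ^ m = 1 := fun μ hμ =>
    h μ ((Module.End.hasEigenvalue_iff_isRoot_charpoly T μ).2 (Polynomial.isRoot_of_mem_roots hμ))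
  choose! k hk_pos hk using hroot
  set m := ∏ μ ∈ T.charpoly.roots.toFinset, k μ
  have hm : ∀ μ ∈ T.charpoly.roots, μ ^ m = 1 := fun μ hμ =>
    orderOf_dvd_iff_pow_eq_one.1 <| (orderOf_dvd_of_pow_eq_one (hk μ hμ)).trans <|
      Finset.dvd_prod_of_mem k (Multiset.mem_toFinset.2 hμ)
  refine ⟨m, T.charpoly.roots.card,
    Finset.prod_pos fun μ hμ => hk_pos μ (Multiset.mem_toFinset.1 hμ), ?_⟩
  have hdvd : T.charpoly ∣ (Polynomial.X ^ m - 1) ^ T.charpoly.roots.card := by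
    rw [← Multiset.prod_replicate, ← Multiset.map_const']
    nth_rewrite 1 [(IsAlgClosed.splits T.charpoly).eq_prod_roots_of_monic T.charpoly_monic]
    refine Multiset.prod_dvd_prod_of_dvd _ _ fun μ hμ => ?_
    rw [Polynomial.dvd_iff_isRoot]
    simp [hm μ hμ]
  rw [pow_succ]
  simpa using! congrArg (· * (T ^ m - 1)) <|
    Polynomial.aeval_eq_zero_of_dvd_aeval_eq_zero hdvd T.aeval_self_charpoly

theorem coe_deckShift (δ : ℝ) (k : ℤ) (w : logDisk δ) :
    (deckShift δ k w : ℂ) = w + k * (2 * Real.pi * Complex.I) := rfl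

theorem mem_branchSpace_self {δ : ℝ} (f : logDisk δ → ℂ) : f ∈ branchSpace δ f :=
  Submodule.subset_span ⟨0, funext fun w => congrArg f (Subtype.ext (by simp [coe_deckShift]))⟩

theorem monodromy_mem_branchSpace {δ : ℝ} {f v : logDisk δ → ℂ} (hv : v ∈ branchSpace δ f) :
    monodromy δ v ∈ branchSpace δ f := by
  have h : branchSpace δ f ≤ (branchSpace δ f).comap (monodromy δ) := by
    refine Submodule.span_le.2 ?_
    rintro _ ⟨k, rfl⟩
    refine Submodule.subset_span ⟨k + 1, funext fun w => congrArg f (Subtype.ext ?_)⟩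
    simp only [coe_deckShift]
    push_cast
    ring
  exact h hv

theorem monodromy_pow_domRestrict (δ : ℝ) (g : ℂ → ℂ) (m : ℕ) :
    (monodromy δ ^ m) ((logDisk δ).domRestrict g) =
      (logDisk δ).domRestrict fun w => g (w + m * (2 * Real.pi * Complex.I)) := by
  induction m with
  | zero => simp
  | succ m ih =>
    rw [pow_succ', Module.End.mul_apply, ih]
    refine funext fun w => congrArg g ?_
    rw [coe_deckShift]
    push_cast
    ring

theorem monodromy_pow_sub_one_pow_domRestrict (δ : ℝ) (g : ℂ → ℂ) (m ν : ℕ) :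
    ((monodromy δ ^ m - 1) ^ ν) ((logDisk δ).domRestrict g) =
      (logDisk δ).domRestrict ((fwdDiff (m * (2 * Real.pi * Complex.I) : ℂ))^[ν] g) := by
  induction ν generalizing g with
  | zero => simp
  | succ ν ih =>
    rw [pow_succ, Module.End.mul_apply, Function.iterate_succ_apply, ← ih, LinearMap.sub_apply,
      monodromy_pow_domRestrict]
    rfl

theorem exists_iterate_fwdDiff_eq_zero {δ : ℝ} {f : ℂ → ℂ}
    (hfin : FiniteDimensional ℂ (branchSpace δ ((logDisk δ).domRestrict f)))
    (heig : ∀ (μ : ℂ) (v : logDisk δ → ℂ), v ∈ branchSpace δ ((logDisk δ).domRestrict f) →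
      (monodromy δ).HasEigenvector μ v → ∃ m : ℕ, 0 < m ∧ μ ^ m = 1) :
    ∃ m ν : ℕ, 0 < m ∧
      ∀ w ∈ logDisk δ, (fwdDiff (m * (2 * Real.pi * Complex.I) : ℂ))^[ν + 1] f w = 0 := by
  set V := branchSpace δ ((logDisk δ).domRestrict f)
  set T : Module.End ℂ V := (monodromy δ).restrict fun _ => monodromy_mem_branchSpace
  obtain ⟨m, ν, hm, h0⟩ := exists_pow_sub_one_pow_eq_zero T fun μ hμ => by
    obtain ⟨v, hv⟩ := hμ.exists_hasEigenvector
    refine heig μ v v.2 ⟨Module.End.mem_eigenspace_iff.2 ?_, fun h => hv.2 (Subtype.ext h)⟩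
    exact congrArg Subtype.val hv.apply_eq_smul
  refine ⟨m, ν, hm, fun w hw => ?_⟩
  have hT : Function.Semiconj (Subtype.val : V → logDisk δ → ℂ) T (monodromy δ) := fun _ => rfl
  have hTm : Function.Semiconj (Subtype.val : V → logDisk δ → ℂ) (T ^ m - 1 : Module.End ℂ V)
      (monodromy δ ^ m - 1 : Module.End ℂ (logDisk δ → ℂ)) := fun v => by
    have := hT.iterate_right m v
    simp only [LinearMap.sub_apply, Module.End.pow_apply, Submodule.coe_sub, Module.End.one_apply,
      this]
  have h1 := hTm.iterate_right (ν + 1) ⟨_, mem_branchSpace_self ((logDisk δ).domRestrict f)⟩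
  rw [← Module.End.pow_apply, ← Module.End.pow_apply, h0,
    monodromy_pow_sub_one_pow_domRestrict] at h1
  exact (congrFun h1 ⟨w, hw⟩).symm

theorem iterate_fwdDiff_mul_periodic {a : ℂ} (u : ℂ → ℂ) {g : ℂ → ℂ} (hg : Function.Periodic g a)
    (n : ℕ) : (fwdDiff a)^[n] (u * g) = (fwdDiff a)^[n] u * g := by
  have h : Function.Semiconj (· * g) (fwdDiff a) (fwdDiff a) := fun u => by
    funext w
    simp only [Pi.mul_apply, fwdDiff, hg w]
    ring
  exact (h.iterate_right n u).symm

theorem iterate_fwdDiff_pow {a : ℂ} (ha : a ≠ 0) (n : ℕ) :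
    (fwdDiff a)^[n] (fun w => w ^ n) = fun _ => (n.factorial : ℂ) * a ^ n := by
  have h : Function.Semiconj (fun (u : ℂ → ℂ) w => u (w / a)) (fwdDiff 1) (fwdDiff a) := fun u => by
    funext w
    simp only [fwdDiff, add_div, div_self ha]
  have hpow : (fun w : ℂ => w ^ n) = a ^ n • fun w => (w / a) ^ n := by
    funext w
    simp only [Pi.smul_apply, smul_eq_mul, ← mul_pow, mul_div_cancel₀ w ha]
  rw [hpow, fwdDiff_iter_const_smul, ← h.iterate_right n fun w => w ^ n, fwdDiff_iter_eq_factorial]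
  simp [funext_iff, mul_comm]

theorem exists_eq_sum_pow_mul_periodic {a : ℂ} (ha : a ≠ 0) {A : Subalgebra ℂ (ℂ → ℂ)}
    (hid : id ∈ A) (hA : ∀ f ∈ A, fwdDiff a f ∈ A) (ν : ℕ) {f : ℂ → ℂ} (hf : f ∈ A)
    (h : (fwdDiff a)^[ν] f = 0) :
    ∃ g : ℕ → ℂ → ℂ, (∀ β, g β ∈ A ∧ Function.Periodic (g β) a) ∧
      f = ∑ β ∈ Finset.range ν, id ^ β * g β := by
  induction ν generalizing f with
  | zero => exact ⟨fun _ => 0, fun _ => ⟨A.zero_mem, fun _ => rfl⟩, by simpa using h⟩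
  | succ ν ih =>
    set g₀ : ℂ → ℂ := ((ν.factorial : ℂ) * a ^ ν)⁻¹ • (fwdDiff a)^[ν] f
    have hg₀ : g₀ ∈ A :=
      A.smul_mem (Set.MapsTo.iterate (s := (A : Set (ℂ → ℂ))) hA ν hf) _
    have hper : Function.Periodic g₀ a := fun w => by
      rw [Function.iterate_succ_apply'] at h
      simp only [g₀, Pi.smul_apply, sub_eq_zero.1 (congrFun h w)]
    have htop : (fwdDiff a)^[ν] (id ^ ν * g₀) = (fwdDiff a)^[ν] f := by
      rw [iterate_fwdDiff_mul_periodic _ hper,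
        show (id ^ ν : ℂ → ℂ) = fun w => w ^ ν from rfl, iterate_fwdDiff_pow ha]
      funext w
      have : (ν.factorial : ℂ) * a ^ ν ≠ 0 :=
        mul_ne_zero (Nat.cast_ne_zero.2 ν.factorial_ne_zero) (pow_ne_zero ν ha)
      simp only [g₀, Pi.mul_apply, Pi.smul_apply, smul_eq_mul, mul_inv_cancel_left₀ this]
    obtain ⟨g, hg, hsum⟩ := ih (A.sub_mem hf (A.mul_mem (A.pow_mem hid ν) hg₀)) <| by
      rw [← fwdDiff_aux.coe_fwdDiffₗ_pow, map_sub, fwdDiff_aux.coe_fwdDiffₗ_pow, htop, sub_self]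
    refine ⟨Function.update g ν g₀, fun β => ?_, ?_⟩
    · rcases eq_or_ne β ν with rfl | hβ
      · simpa using ⟨hg₀, hper⟩
      · simpa [hβ] using hg β
    · rw [Finset.sum_range_succ, Function.update_self, ← sub_eq_iff_eq_add, hsum]
      refine Finset.sum_congr rfl fun β hβ => ?_
      rw [Function.update_of_ne (Finset.mem_range.1 hβ).ne]

/-- The filter of neighbourhoods of `re w = -∞` in the strip `|im w| ≤ M`. -/
def leftStrip (M : ℝ) : Filter ℂ :=
  comap Complex.re atBot ⊓ 𝓟 {w | |w.im| ≤ M}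

theorem tendsto_exp_leftStrip (M : ℝ) : Tendsto Complex.exp (leftStrip M) (𝓝 0) :=
  Complex.tendsto_exp_comap_re_atBot.mono_left inf_le_left

theorem tendsto_add_leftStrip {a : ℂ} (ha : a.re = 0) (M : ℝ) :
    Tendsto (· + a) (leftStrip M) (leftStrip (M + |a.im|)) := by
  refine Tendsto.inf ?_ (tendsto_principal_principal.2 fun w hw => ?_)
  · exact tendsto_comap_iff.2 (by simpa [Function.comp_def, ha] using tendsto_comap)
  · have hw : |w.im| ≤ M := hw
    rw [Set.mem_ofPred_eq, Complex.add_im]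
    exact (abs_add_le _ _).trans (add_le_add_left hw |a.im|)

theorem isBigO_exp_neg_pow_of_le {N N' : ℕ} (h : N ≤ N') (M : ℝ) :
    (fun w => Complex.exp (-w) ^ N) =O[leftStrip M] fun w => Complex.exp (-w) ^ N' := by
  have h1 : (fun w => Complex.exp w ^ (N' - N)) =O[leftStrip M] fun _ => (1 : ℂ) :=
    ((tendsto_exp_leftStrip M).pow _).isBigO_one ℂ
  refine ((h1.mul (Asymptotics.isBigO_refl (fun w => Complex.exp (-w) ^ N') _)).congr_left
    fun w => ?_).trans (by simp only [one_mul, Asymptotics.isBigO_refl])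
  rw [← Nat.add_sub_cancel' h, pow_add, Nat.add_sub_cancel_left, mul_left_comm, ← mul_pow,
    ← Complex.exp_add, add_neg_cancel, Complex.exp_zero, one_pow, mul_one]

theorem isBigO_id_exp_neg (M : ℝ) :
    (fun w => w) =O[leftStrip M] fun w => Complex.exp (-w) := by
  have h0 : ∀ᶠ w in leftStrip M, w.re ≤ 0 :=
    (tendsto_comap.mono_left inf_le_left).eventually (eventually_le_atBot 0)
  have hM : ∀ᶠ w in leftStrip M, |w.im| ≤ M := eventually_inf_principal.2 (by simp)
  refine Asymptotics.IsBigO.of_bound (1 + M) ?_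
  filter_upwards [h0, hM] with w h0 hM
  have h1 := Complex.norm_le_abs_re_add_abs_im w
  have h2 := Real.add_one_le_exp (-w.re)
  rw [abs_of_nonpos h0] at h1
  rw [Complex.norm_exp, Complex.neg_re]
  nlinarith [abs_nonneg w.im]

/-- The functions of moderate growth towards `re w = -∞`: they are holomorphic far to the left,
and bounded by a power of `‖exp w‖⁻¹` on every horizontal strip. -/
def moderateGrowthSubalgebra : Subalgebra ℂ (ℂ → ℂ) where
  carrier := {f | (∀ᶠ w in comap Complex.re atBot, DifferentiableAt ℂ f w) ∧
    ∀ M : ℝ, ∃ N : ℕ, f =O[leftStrip M] fun w => Complex.exp (-w) ^ N}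
  mul_mem' := by
    rintro f g ⟨hf, hf_growth⟩ ⟨hg, hg_growth⟩
    refine ⟨hf.mp (hg.mono fun w hg hf => hf.mul hg), fun M => ?_⟩
    obtain ⟨N₁, h₁⟩ := hf_growth M
    obtain ⟨N₂, h₂⟩ := hg_growth M
    exact ⟨N₁ + N₂, (h₁.mul h₂).congr_right fun w => (pow_add _ _ _).symm⟩
  add_mem' := by
    rintro f g ⟨hf, hf_growth⟩ ⟨hg, hg_growth⟩
    refine ⟨hf.mp (hg.mono fun w hg hf => hf.add hg), fun M => ?_⟩
    obtain ⟨N₁, h₁⟩ := hf_growth M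
    obtain ⟨N₂, h₂⟩ := hg_growth M
    exact ⟨max N₁ N₂, (h₁.trans (isBigO_exp_neg_pow_of_le (le_max_left _ _) M)).add
      (h₂.trans (isBigO_exp_neg_pow_of_le (le_max_right _ _) M))⟩
  algebraMap_mem' c := by
    refine ⟨Eventually.of_forall fun w => differentiableAt_const c, fun M => ⟨0, ?_⟩⟩
    simpa only [pow_zero] using! Asymptotics.isBigO_const_const c (one_ne_zero (α := ℂ)) _

theorem id_mem_moderateGrowthSubalgebra : id ∈ moderateGrowthSubalgebra :=
  ⟨Eventually.of_forall fun _ => differentiableAt_id,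
    fun M => ⟨1, by simpa only [pow_one] using! isBigO_id_exp_neg M⟩⟩

theorem fwdDiff_mem_moderateGrowthSubalgebra {a : ℂ} (ha : a.re = 0) {f : ℂ → ℂ}
    (hf : f ∈ moderateGrowthSubalgebra) : fwdDiff a f ∈ moderateGrowthSubalgebra := by
  refine moderateGrowthSubalgebra.sub_mem (x := fun w => f (w + a)) ⟨?_, fun M => ?_⟩ hf
  · have hshift : Tendsto (· + a) (comap Complex.re atBot) (comap Complex.re atBot) :=
      tendsto_comap_iff.2 (by simpa [Function.comp_def, ha] using tendsto_comap)
    filter_upwards [hshift.eventually hf.1] with w hw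
    exact hw.comp w (differentiableAt_id.add_const a)
  · obtain ⟨N, hN⟩ := hf.2 (M + |a.im|)
    have hnorm : ∀ w, ‖Complex.exp (-(w + a)) ^ N‖ = ‖Complex.exp (-w) ^ N‖ := fun w => by
      simp [Complex.norm_exp, ha]
    exact ⟨N, ((hN.comp_tendsto (tendsto_add_leftStrip ha M)).norm_right.congr_right
      hnorm).of_norm_right⟩

theorem exists_abs_im_add_int_mul_le {p : ℝ} (hp : 0 < p) (w : ℂ) :
    ∃ k : ℤ, |(w + k * (p * Complex.I)).im| ≤ p / 2 := by
  refine ⟨-round (w.im / p), ?_⟩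
  have him : (w + (-round (w.im / p) : ℤ) * (p * Complex.I)).im =
      (w.im / p - round (w.im / p)) * p := by
    simp
    field_simp
    ring
  rw [him, abs_mul, abs_of_pos hp]
  nlinarith [abs_sub_round (w.im / p)]

theorem isBigO_one_of_periodic_of_leftStrip {p : ℝ} (hp : 0 < p) {F : ℂ → ℂ}
    (hper : Function.Periodic F (p * Complex.I))
    (hF : F =O[leftStrip (p / 2)] fun _ => (1 : ℝ)) :
    F =O[comap Complex.re atBot] fun _ => (1 : ℝ) := by
  obtain ⟨C, hC⟩ := hF.bound
  rw [leftStrip, eventually_inf_principal, eventually_comap] at hC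
  refine Asymptotics.IsBigO.of_bound C (eventually_comap.2 (hC.mono ?_))
  rintro _ hw w rfl
  obtain ⟨k, hk⟩ := exists_abs_im_add_int_mul_le hp w
  rw [← hper.int_mul k w]
  exact hw _ (by simp) hk

theorem exists_analyticAt_of_periodic {m : ℕ} (hm : 0 < m) {F : ℂ → ℂ}
    (hper : Function.Periodic F (m * (2 * Real.pi * Complex.I)))
    (hF : ∀ᶠ w in comap Complex.re atBot, DifferentiableAt ℂ F w)
    (hbd : F =O[leftStrip (m * Real.pi)] fun _ => (1 : ℝ)) :
    ∃ h : ℂ → ℂ, AnalyticAt ℂ h 0 ∧ ∀ w, F w = h (Complex.exp (w / m)) := by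
  have hm' : (0 : ℝ) < m := Nat.cast_pos.2 hm
  set f : ℂ → ℂ := fun z => F (2 * Real.pi * Complex.I * z)
  have hf_per : Function.Periodic f (m : ℝ) := fun z => by
    have := hper (2 * Real.pi * Complex.I * z)
    rwa [mul_comm (m : ℂ), ← mul_add] at this
  have htend : Tendsto (fun z : ℂ => 2 * Real.pi * Complex.I * z) (comap Complex.im atTop)
      (comap Complex.re atBot) := by
    refine tendsto_comap_iff.2 ?_
    have hre : (Complex.re ∘ fun z : ℂ => 2 * Real.pi * Complex.I * z) =
        fun z => -(2 * Real.pi * z.im) := by funext z; simp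
    rw [hre]
    exact tendsto_neg_atTop_atBot.comp (tendsto_comap.const_mul_atTop (by positivity))
  have hf_diff : ∀ᶠ z in comap Complex.im atTop, DifferentiableAt ℂ f z :=
    (htend.eventually hF).mono fun z hz => hz.comp z (by fun_prop)
  have hf_bd : (comap Complex.im atTop).BoundedAtFilter f := by
    refine (isBigO_one_of_periodic_of_leftStrip (p := m * (2 * Real.pi)) (by positivity)
      (by simpa [mul_assoc] using hper) ?_).comp_tendsto htend
    rwa [mul_div_assoc, mul_div_cancel_left₀ _ two_ne_zero]
  refine ⟨Function.Periodic.cuspFunction m f, ?_, fun w => ?_⟩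
  · rw [Complex.analyticAt_iff_eventually_differentiableAt]
    have h1 := Function.Periodic.eventually_differentiableAt_cuspFunction_nhds_ne_zero hm' hf_per
      hf_diff
    have h2 := Function.Periodic.differentiableAt_cuspFunction_zero hm' hf_per hf_diff hf_bd
    filter_upwards [eventually_nhdsWithin_iff.1 h1] with z hz
    rcases eq_or_ne z 0 with rfl | hne
    exacts [h2, hz hne]
  · have h1 := Function.Periodic.eq_cuspFunction hm'.ne' hf_per (w / (2 * Real.pi * Complex.I))
    simpa [f, Function.Periodic.qParam, mul_div_cancel₀ w Complex.two_pi_I_ne_zero] using h1.symm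

/-- `f` agrees, far to the left, with `exp (-w) ^ N` times a polynomial in `w` of degree at most
`ν`, whose coefficients `g β (exp (w / m))` are convergent power series in `exp (w / m)`. -/
def HasLogPuiseuxForm (f : ℂ → ℂ) (m N ν : ℕ) (g : ℕ → ℂ → ℂ) : Prop :=
  (∀ β, AnalyticAt ℂ (g β) 0) ∧ ∀ᶠ w in comap Complex.re atBot,
    f w = Complex.exp (-w) ^ N * ∑ β ∈ Finset.range (ν + 1), w ^ β * g β (Complex.exp (w / m))

theorem exists_eq_exp_neg_pow_mul_of_periodic {m : ℕ} (hm : 0 < m) {f : ℂ → ℂ}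
    (hf : f ∈ moderateGrowthSubalgebra)
    (hper : Function.Periodic f (m * (2 * Real.pi * Complex.I))) :
    ∃ N₀, ∀ N ≥ N₀, ∃ g : ℂ → ℂ, AnalyticAt ℂ g 0 ∧
      ∀ w, f w = Complex.exp (-w) ^ N * g (Complex.exp (w / m)) := by
  obtain ⟨N₀, hN₀⟩ := hf.2 (m * Real.pi)
  have hmul : ∀ (N : ℕ) (w : ℂ), Complex.exp (-w) ^ N * Complex.exp w ^ N = 1 := fun N w => by
    rw [← mul_pow, ← Complex.exp_add, neg_add_cancel, Complex.exp_zero, one_pow]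
  refine ⟨N₀, fun N hN => ?_⟩
  have hper' : Function.Periodic (fun w => Complex.exp w ^ N * f w)
      (m * (2 * Real.pi * Complex.I)) := fun w => by
    simp only [hper w, Complex.exp_periodic.nat_mul m w]
  have hbd : (fun w => Complex.exp w ^ N * f w) =O[leftStrip (m * Real.pi)] fun _ => (1 : ℝ) := by
    refine ((Asymptotics.isBigO_refl (fun w => Complex.exp w ^ N) _).mul
      (hN₀.trans (isBigO_exp_neg_pow_of_le hN _))).trans ?_
    refine (Asymptotics.isBigO_const_const (1 : ℂ) one_ne_zero _).congr_left fun w => ?_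
    rw [mul_comm, hmul]
  obtain ⟨g, hg, hgf⟩ := exists_analyticAt_of_periodic hm hper'
    (hf.1.mono fun w hw => by fun_prop) hbd
  refine ⟨g, hg, fun w => ?_⟩
  rw [← hgf, ← mul_assoc, hmul, one_mul]

theorem exists_hasLogPuiseuxForm_of_iterate_fwdDiff_eq_zero {f : ℂ → ℂ}
    (hf : f ∈ moderateGrowthSubalgebra) {m ν : ℕ} (hm : 0 < m)
    (h : (fwdDiff (m * (2 * Real.pi * Complex.I) : ℂ))^[ν + 1] f = 0) :
    ∃ (N : ℕ) (g : ℕ → ℂ → ℂ), HasLogPuiseuxForm f m N ν g := by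
  obtain ⟨u, hu, hfu⟩ := exists_eq_sum_pow_mul_periodic
    (mul_ne_zero (Nat.cast_ne_zero.2 hm.ne') Complex.two_pi_I_ne_zero)
    id_mem_moderateGrowthSubalgebra
    (fun _ => fwdDiff_mem_moderateGrowthSubalgebra (by simp)) (ν + 1) hf h
  choose N₀ hN₀ using fun β => exists_eq_exp_neg_pow_mul_of_periodic hm (hu β).1 (hu β).2
  choose! g hg hgu using hN₀
  refine ⟨(Finset.range (ν + 1)).sup N₀, fun β => g β (max (N₀ β) ((Finset.range (ν + 1)).sup N₀)),
    fun β => hg β _ (le_max_left _ _), Eventually.of_forall fun w => ?_⟩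
  rw [hfu, Finset.sum_apply, Finset.mul_sum]
  refine Finset.sum_congr rfl fun β hβ => ?_
  have hN : N₀ β ≤ (Finset.range (ν + 1)).sup N₀ := Finset.le_sup hβ
  simp only [max_eq_right hN, Pi.mul_apply, Pi.pow_apply, id]
  rw [mul_left_comm, ← hgu β _ hN]

theorem isOpen_logDisk (δ : ℝ) : IsOpen (logDisk δ) :=
  isOpen_lt Complex.continuous_exp.norm continuous_const

theorem logDisk_mem_comap_re_atBot {δ : ℝ} (hδ : 0 < δ) : logDisk δ ∈ comap Complex.re atBot :=
  Complex.tendsto_exp_comap_re_atBot.norm.eventually_lt_const (by simpa using hδ)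

theorem iterate_fwdDiff_indicator {s : Set ℂ} {a : ℂ} (hs : ∀ w, w + a ∈ s ↔ w ∈ s) (f : ℂ → ℂ)
    (n : ℕ) : (fwdDiff a)^[n] (s.indicator f) = s.indicator ((fwdDiff a)^[n] f) := by
  have h : Function.Semiconj s.indicator (fwdDiff a) (fwdDiff a : (ℂ → ℂ) → ℂ → ℂ) := fun f => by
    funext w
    by_cases hw : w ∈ s <;> simp [fwdDiff, hs, hw]
  exact (h.iterate_right n f).symm

theorem indicator_logDisk_mem_moderateGrowthSubalgebra {δ : ℝ} (hδ : 0 < δ) {f : ℂ → ℂ}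
    (hf : DifferentiableOn ℂ f (logDisk δ)) (hgrowth : HasModerateGrowth δ f) :
    (logDisk δ).indicator f ∈ moderateGrowthSubalgebra := by
  have hmem := logDisk_mem_comap_re_atBot hδ
  refine ⟨?_, fun M => ?_⟩
  · filter_upwards [hmem] with w hw
    have hnhds := (isOpen_logDisk δ).mem_nhds hw
    exact (hf.differentiableAt hnhds).congr_of_eventuallyEq
      (Set.eqOn_indicator.eventuallyEq_of_mem hnhds)
  · obtain ⟨C, N, hC⟩ := hgrowth M
    refine ⟨N, Asymptotics.IsBigO.of_bound C ?_⟩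
    filter_upwards [mem_inf_of_left hmem, mem_inf_of_right (mem_principal_self _)] with w hw hwM
    rw [Set.indicator_of_mem hw, norm_pow, Complex.exp_neg, norm_inv]
    exact hC w hw hwM

theorem HasQuasiUnipotentMonodromyAt.exists_hasLogPuiseuxForm {G : ℂ → ℂ} {p : ℂ}
    (h : HasQuasiUnipotentMonodromyAt G p) :
    ∃ (m N ν : ℕ) (g : ℕ → ℂ → ℂ) (f : ℂ → ℂ), 0 < m ∧ HasLogPuiseuxForm f m N ν g ∧
      ∀ᶠ w in comap Complex.re atBot, |w.im| < Real.pi → f w = G (p * (1 - Complex.exp w)) := by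
  obtain ⟨δ, hδ, f, hf, hfG, hgrowth, hfin, heig⟩ := h
  obtain ⟨m, ν, hm, hν⟩ := exists_iterate_fwdDiff_eq_zero hfin heig
  have hshift : ∀ w, w + m * (2 * Real.pi * Complex.I) ∈ logDisk δ ↔ w ∈ logDisk δ := fun w => by
    simp only [logDisk, Set.mem_ofPred_eq, Complex.exp_periodic.nat_mul m w]
  obtain ⟨N, g, hg⟩ := exists_hasLogPuiseuxForm_of_iterate_fwdDiff_eq_zero (ν := ν)
    (indicator_logDisk_mem_moderateGrowthSubalgebra hδ hf hgrowth) hm <| by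
      rw [iterate_fwdDiff_indicator hshift, Set.indicator_eq_zero']
      exact Set.disjoint_left.2 fun w hw hwδ => hw (hν w hwδ)
  refine ⟨m, N, ν, g, _, hm, hg, ?_⟩
  filter_upwards [logDisk_mem_comap_re_atBot hδ] with w hw him
  rw [Set.indicator_of_mem hw, hfG w hw him]

/-! ### Continuation of a log-Puiseux form to its branch point -/

theorem eventually_eq_zero_of_forall_isBigO_pow {f : ℂ → ℂ} (hf : AnalyticAt ℂ f 0)
    (hO : ∀ J : ℕ, f =O[𝓝[≠] 0] fun x => x ^ J) : ∀ᶠ x in 𝓝 0, f x = 0 := by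
  refine analyticOrderAt_eq_top.1 (ENat.eq_top_iff_forall_ge.2 fun J => ?_)
  simpa only [sub_zero] using (natCast_le_analyticOrderAt hf).2
    (by simpa only [sub_zero] using exists_eventuallyEq_pow_smul_of_isBigO hf (hO J))

theorem polynomial_eq_zero_of_tendsto {𝕜 : Type*} [NormedField 𝕜] {P : Polynomial 𝕜} {ι : Type*}
    {l : Filter ι} [l.NeBot] {v : ι → 𝕜} (hv : Tendsto (fun i => ‖v i‖) l atTop)
    (hP : Tendsto (fun i => P.eval (v i)) l (𝓝 0)) : P = 0 := by
  rcases lt_or_ge 0 P.degree with hdeg | hdeg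
  · exact absurd hP.norm (not_tendsto_nhds_of_tendsto_atTop (P.tendsto_norm_atTop hdeg hv) _)
  · rw [Polynomial.eq_C_of_degree_le_zero hdeg] at hP ⊢
    simp only [Polynomial.eval_C] at hP
    rw [tendsto_nhds_unique tendsto_const_nhds hP, map_zero]

theorem tendsto_exp_ofReal_atBot : Tendsto (fun v : ℝ => Complex.exp v) atBot (𝓝 0) :=
  Complex.tendsto_exp_comap_re_atBot.comp (tendsto_comap_iff.2 tendsto_id)

theorem tendsto_pow_mul_exp_ofReal_atBot (β : ℕ) :
    Tendsto (fun v : ℝ => (v : ℂ) ^ β * Complex.exp v) atBot (𝓝 0) := by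
  refine tendsto_zero_iff_norm_tendsto_zero.2 ?_
  have h := ((Real.tendsto_pow_mul_exp_neg_atTop_nhds_zero β).comp tendsto_neg_atBot_atTop).norm
  simpa [Function.comp_def, Complex.norm_exp, abs_pow] using h

theorem apply_zero_eq_zero_of_isBigO_sum_pow_mul {s : Finset ℕ} {k : ℕ → ℂ → ℂ}
    (hk : ∀ β ∈ s, AnalyticAt ℂ (k β) 0)
    (hO : (fun v : ℝ => ∑ β ∈ s, (v : ℂ) ^ β * k β (Complex.exp v))
      =O[atBot] fun v : ℝ => Complex.exp v) : ∀ β ∈ s, k β 0 = 0 := by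
  have hrem : ∀ β ∈ s, Tendsto (fun v : ℝ => (v : ℂ) ^ β * (k β (Complex.exp v) - k β 0)) atBot
      (𝓝 0) := fun β hβ => by
    have hdiff : (fun v : ℝ => k β (Complex.exp v) - k β 0) =O[atBot]
        fun v : ℝ => Complex.exp v := by
      simpa only [Function.comp_def, sub_zero] using
        (hk β hβ).differentiableAt.isBigO_sub.comp_tendsto tendsto_exp_ofReal_atBot
    exact ((Asymptotics.isBigO_refl _ _).mul hdiff).trans_tendsto
      (tendsto_pow_mul_exp_ofReal_atBot β)
  let P : Polynomial ℂ := ∑ β ∈ s, Polynomial.C (k β 0) * Polynomial.X ^ β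
  have hP : P = 0 := by
    refine polynomial_eq_zero_of_tendsto (l := atBot) (v := fun v : ℝ => (v : ℂ))
      (by simpa only [Complex.norm_real] using! tendsto_abs_atBot_atTop) ?_
    have h := (hO.trans_tendsto tendsto_exp_ofReal_atBot).sub (tendsto_finsetSum s hrem)
    simp only [Finset.sum_const_zero, sub_zero, ← Finset.sum_sub_distrib] at h
    refine h.congr fun v => ?_
    simp only [P, Polynomial.eval_finsetSum, Polynomial.eval_C_mul, Polynomial.eval_X_pow]
    exact Finset.sum_congr rfl fun β _ => by ring
  intro β hβ
  have hcoeff : P.coeff β = k β 0 := by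
    simp only [P, Polynomial.finsetSum_coeff, Polynomial.coeff_C_mul_X_pow, Finset.sum_ite_eq,
      if_pos hβ]
  rw [← hcoeff, hP, Polynomial.coeff_zero]

theorem isBigO_pow_of_isBigO_sum_pow_mul {s : Finset ℕ} {h : ℕ → ℂ → ℂ}
    (hh : ∀ β ∈ s, AnalyticAt ℂ (h β) 0) {J : ℕ}
    (hO : (fun v : ℝ => ∑ β ∈ s, (v : ℂ) ^ β * h β (Complex.exp v))
      =O[atBot] fun v : ℝ => Complex.exp v ^ J) :
    ∀ β ∈ s, h β =O[𝓝 0] fun x => x ^ J := by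
  induction J generalizing h with
  | zero =>
    intro β hβ
    simpa only [pow_zero] using (hh β hβ).continuousAt.isBigO_one ℂ
  | succ J ih =>
    have hpow : (fun v : ℝ => Complex.exp v ^ (J + 1)) =O[atBot] fun v : ℝ => Complex.exp v := by
      simpa only [pow_succ, one_mul] using!
        ((tendsto_exp_ofReal_atBot.pow J).isBigO_one ℂ).mul (Asymptotics.isBigO_refl _ _)
    have h0 := apply_zero_eq_zero_of_isBigO_sum_pow_mul hh (hO.trans hpow)
    choose! k hk hhk using fun β (hβ : β ∈ s) =>
      exists_eventuallyEq_pow_smul_of_isBigO (m := 1) (hh β hβ) <| by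
        simpa only [h0 β hβ, sub_zero, pow_one] using
          (hh β hβ).differentiableAt.isBigO_sub.mono nhdsWithin_le_nhds
    have hkO : (fun v : ℝ => ∑ β ∈ s, (v : ℂ) ^ β * k β (Complex.exp v)) =O[atBot]
        fun v : ℝ => Complex.exp v ^ J := by
      refine ((Asymptotics.isBigO_refl (fun v : ℝ => (Complex.exp v)⁻¹) atBot).mul hO).congr' ?_
        (.of_forall fun v => by simp only [pow_succ', inv_mul_cancel_left₀ (Complex.exp_ne_zero _)])
      filter_upwards [(Finset.eventually_all s).2 fun β hβ =>
        tendsto_exp_ofReal_atBot.eventually (hhk β hβ)] with v hv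
      rw [Finset.mul_sum]
      refine Finset.sum_congr rfl fun β hβ => ?_
      rw [hv β hβ, smul_eq_mul]
      field_simp
    intro β hβ
    refine ((Asymptotics.isBigO_refl (fun x : ℂ => x) (𝓝 0)).mul (ih hk hkO β hβ)).congr' ?_
      (.of_forall fun x => (pow_succ' x J).symm)
    filter_upwards [hhk β hβ] with x hx
    rw [hx, pow_one, smul_eq_mul]

theorem isBigO_pow_pow_nhds_zero {i j : ℕ} (h : i ≤ j) :
    (fun x : ℂ => x ^ j) =O[𝓝 0] fun x => x ^ i :=
  h.eq_or_lt.elim (fun h => h ▸ Asymptotics.isBigO_refl _ _)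
    fun h => (Asymptotics.isLittleO_pow_pow h).isBigO

theorem tendsto_exp_div_comap_re_atBot {m : ℕ} (hm : 0 < m) :
    Tendsto (fun w : ℂ => Complex.exp (w / m)) (comap Complex.re atBot) (𝓝 0) := by
  refine Complex.tendsto_exp_comap_re_atBot.comp (tendsto_comap_iff.2 ?_)
  simpa only [Function.comp_def, Complex.div_natCast_re] using
    tendsto_comap.atBot_div_const (Nat.cast_pos.2 hm)

theorem exists_analyticAt_comp_exp_div {m : ℕ} (hm : 0 < m) {k : ℂ → ℂ} (hk : AnalyticAt ℂ k 0)
    (hinv : ∀ᶠ x in 𝓝 0, k (Complex.exp (2 * Real.pi * Complex.I / m) * x) = k x) :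
    ∃ h : ℂ → ℂ, AnalyticAt ℂ h 0 ∧
      ∀ᶠ w in comap Complex.re atBot, k (Complex.exp (w / m)) = h (Complex.exp w) := by
  set u := Complex.exp (2 * Real.pi * Complex.I / m)
  have hu : ‖u‖ = 1 := (Complex.isPrimitiveRoot_exp m hm.ne').norm'_eq_one hm.ne'
  obtain ⟨ρ, hρ, hball⟩ := Metric.eventually_nhds_iff_ball.1
    (hinv.and (hk.eventually_analyticAt.and (hk.continuousAt.norm.eventually_lt_const
      (lt_add_one _))))
  have hnear : ∀ᶠ w : ℂ in comap Complex.re atBot, Complex.exp (w / m) ∈ Metric.ball (0 : ℂ) ρ :=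
    (tendsto_exp_div_comap_re_atBot hm).eventually (Metric.ball_mem_nhds 0 hρ)
  set F : ℂ → ℂ := fun w => (Metric.ball 0 ρ).indicator k (Complex.exp (w / m))
  have hper : Function.Periodic F ((1 : ℕ) * (2 * Real.pi * Complex.I)) := fun w => by
    have hshift : Complex.exp ((w + (1 : ℕ) * (2 * Real.pi * Complex.I)) / m) =
        u * Complex.exp (w / m) := by
      rw [Nat.cast_one, one_mul, add_div, add_comm, Complex.exp_add]
    have hmem : u * Complex.exp (w / m) ∈ Metric.ball (0 : ℂ) ρ ↔
        Complex.exp (w / m) ∈ Metric.ball (0 : ℂ) ρ := by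
      rw [mem_ball_zero_iff, mem_ball_zero_iff, norm_mul, hu, one_mul]
    simp only [F, hshift]
    by_cases hw : Complex.exp (w / m) ∈ Metric.ball (0 : ℂ) ρ
    · rw [Set.indicator_of_mem (hmem.2 hw), Set.indicator_of_mem hw, (hball _ hw).1]
    · rw [Set.indicator_of_notMem (hmem.not.2 hw), Set.indicator_of_notMem hw]
  have hdiff : ∀ᶠ w in comap Complex.re atBot, DifferentiableAt ℂ F w := hnear.mono fun w hw => by
    have hk' : DifferentiableAt ℂ ((Metric.ball 0 ρ).indicator k) (Complex.exp (w / m)) :=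
      (hball _ hw).2.1.differentiableAt.congr_of_eventuallyEq
        (Set.eqOn_indicator.eventuallyEq_of_mem (Metric.isOpen_ball.mem_nhds hw))
    exact hk'.comp (f := fun w : ℂ => Complex.exp (w / m)) w (by fun_prop)
  have hbd : F =O[leftStrip ((1 : ℕ) * Real.pi)] fun _ => (1 : ℝ) := by
    refine .of_bound (‖k 0‖ + 1) ((hnear.filter_mono inf_le_left).mono fun w hw => ?_)
    simpa only [F, Set.indicator_of_mem hw, norm_one, mul_one] using (hball _ hw).2.2.le
  obtain ⟨h, hh, hF⟩ := exists_analyticAt_of_periodic one_pos hper hdiff hbd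
  refine ⟨h, hh, hnear.mono fun w hw => ?_⟩
  have := hF w
  simp only [F, Set.indicator_of_mem hw, Nat.cast_one, div_one] at this
  exact this

theorem eventually_apply_mul_eq_of_isBigO {m : ℕ} (hm : 0 < m) {k : ℂ → ℂ}
    (hk : AnalyticAt ℂ k 0) {t : ℕ → ℂ} (hkt : ∀ J : ℕ,
      (fun x => k x - ∑ j ∈ Finset.range J, t j * (x ^ m) ^ j) =O[𝓝[≠] 0] fun x => (x ^ m) ^ J)
    {u : ℂ} (hu : u ^ m = 1) : ∀ᶠ x in 𝓝 0, k (u * x) = k x := by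
  have hu0 : u ≠ 0 := fun h => by simp [h, hm.ne'] at hu
  have htend : Tendsto (fun x => u * x) (𝓝[≠] 0) (𝓝[≠] (0 : ℂ)) := by
    refine tendsto_nhdsWithin_iff.2 ⟨?_, eventually_mem_nhdsWithin.mono fun x => mul_ne_zero hu0⟩
    exact Tendsto.mono_left (Continuous.tendsto' (by fun_prop) 0 0 (mul_zero u)) nhdsWithin_le_nhds
  have hku : AnalyticAt ℂ (fun x => k (u * x)) 0 :=
    AnalyticAt.fun_comp (by simpa only [mul_zero] using hk) (by fun_prop)
  refine (eventually_eq_zero_of_forall_isBigO_pow (hku.sub hk) fun J => ?_).mono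
    fun x => sub_eq_zero.1
  have hdiff := ((hkt J).comp_tendsto htend).sub (by
    simpa only [Function.comp_def, mul_pow, hu, one_mul] using hkt J)
  simp only [Function.comp_def, mul_pow, hu, one_mul, sub_sub_sub_cancel_right] at hdiff
  simp only [← pow_mul] at hdiff
  exact hdiff.trans
    ((isBigO_pow_pow_nhds_zero (Nat.le_mul_of_pos_left J hm)).mono nhdsWithin_le_nhds)

namespace HasLogPuiseuxForm

variable {f : ℂ → ℂ} {m N ν : ℕ} {g : ℕ → ℂ → ℂ}

theorem isBigO_sub_ite (hf : HasLogPuiseuxForm f m N ν g) (hm : 0 < m) {J : ℕ} {t : ℕ → ℂ}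
    (hrad : (fun u : ℝ => f u - ∑ j ∈ Finset.range J, t j * Complex.exp u ^ j) =O[atBot]
      fun u : ℝ => Complex.exp u ^ J) : ∀ β ∈ Finset.range (ν + 1),
    (fun x => m ^ β * g β x -
      if β = 0 then x ^ (m * N) * ∑ j ∈ Finset.range J, t j * (x ^ m) ^ j else 0)
      =O[𝓝 0] fun x => x ^ (m * (N + J)) := by
  have hscale : Tendsto (fun v : ℝ => m * v) atBot atBot :=
    tendsto_id.const_mul_atBot (Nat.cast_pos.2 hm)
  have hexp (v : ℝ) : Complex.exp ((m * v : ℝ) : ℂ) = Complex.exp v ^ m := by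
    push_cast
    exact Complex.exp_nat_mul _ _
  refine isBigO_pow_of_isBigO_sum_pow_mul (fun β _ => ?_) ?_
  · have := hf.1 β
    split_ifs <;> fun_prop
  · have hmul := (Asymptotics.isBigO_refl (fun v : ℝ => Complex.exp v ^ (m * N)) atBot).mul
      (hrad.comp_tendsto hscale)
    refine hmul.congr' ?_ (.of_forall fun v => ?_)
    · have hleft : Tendsto (fun v : ℝ => ((m * v : ℝ) : ℂ)) atBot (comap Complex.re atBot) :=
        tendsto_comap_iff.2 hscale
      filter_upwards [hleft.eventually hf.2] with v hv
      simp only [Function.comp_def, hv, hexp, mul_sub, Finset.sum_sub_distrib, mul_ite, mul_zero,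
        Finset.sum_ite_eq', Finset.mem_range, Nat.succ_pos, if_true, pow_zero, one_mul]
      congr 1
      rw [Complex.exp_neg, hexp, ← mul_assoc, pow_mul, ← mul_pow,
        mul_inv_cancel₀ (pow_ne_zero _ (Complex.exp_ne_zero _)), one_pow, one_mul]
      refine Finset.sum_congr rfl fun β _ => ?_
      have hdiv : ((m * v : ℝ) : ℂ) / m = v := by
        push_cast
        exact mul_div_cancel_left₀ _ (Nat.cast_ne_zero.2 hm.ne')
      rw [hdiv]
      push_cast
      ring
    · simp only [Function.comp_def, hexp]
      ring

theorem eventually_coeff_eq_zero (hf : HasLogPuiseuxForm f m N ν g) (hm : 0 < m) {t : ℕ → ℂ}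
    (hrad : ∀ J : ℕ, (fun u : ℝ => f u - ∑ j ∈ Finset.range J, t j * Complex.exp u ^ j) =O[atBot]
      fun u : ℝ => Complex.exp u ^ J) :
    ∀ᶠ x in 𝓝 0, ∀ β ∈ Finset.range (ν + 1), β ≠ 0 → g β x = 0 := by
  simp only [Finset.eventually_all, eventually_imp_distrib_left]
  refine fun β hβ h0 => eventually_eq_zero_of_forall_isBigO_pow (hf.1 β) fun J => ?_
  have hgJ := hf.isBigO_sub_ite hm (hrad J) β hβ
  simp only [if_neg h0, sub_zero, Asymptotics.isBigO_const_mul_left_iff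
    (pow_ne_zero β (Nat.cast_ne_zero.2 hm.ne' : (m : ℂ) ≠ 0))] at hgJ
  have hle : J ≤ m * (N + J) := (Nat.le_add_left J N).trans (Nat.le_mul_of_pos_left _ hm)
  exact (hgJ.trans (isBigO_pow_pow_nhds_zero hle)).mono nhdsWithin_le_nhds

theorem exists_coeff_zero_eq_pow_smul (hf : HasLogPuiseuxForm f m N ν g) (hm : 0 < m) {t : ℕ → ℂ}
    (hrad : ∀ J : ℕ, (fun u : ℝ => f u - ∑ j ∈ Finset.range J, t j * Complex.exp u ^ j) =O[atBot]
      fun u : ℝ => Complex.exp u ^ J) :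
    ∃ k : ℂ → ℂ, AnalyticAt ℂ k 0 ∧ (∀ᶠ x in 𝓝 0, g 0 x = x ^ (m * N) • k x) ∧
      ∀ J : ℕ, (fun x => k x - ∑ j ∈ Finset.range J, t j * (x ^ m) ^ j) =O[𝓝[≠] 0]
        fun x => (x ^ m) ^ J := by
  have hg0 (J : ℕ) : (fun x => g 0 x - x ^ (m * N) * ∑ j ∈ Finset.range J, t j * (x ^ m) ^ j)
      =O[𝓝[≠] 0] fun x => x ^ (m * (N + J)) := by
    simpa only [pow_zero, one_mul, if_true] using
      (hf.isBigO_sub_ite hm (hrad J) 0 (Finset.mem_range.2 ν.succ_pos)).mono nhdsWithin_le_nhds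
  obtain ⟨k, hk, hgk⟩ := exists_eventuallyEq_pow_smul_of_isBigO (m := m * N) (hf.1 0)
    (by simpa using hg0 0)
  refine ⟨k, hk, hgk, fun J => ?_⟩
  refine ((Asymptotics.isBigO_refl (fun x : ℂ => (x ^ (m * N))⁻¹) _).mul (hg0 J)).congr' ?_ ?_
  · filter_upwards [hgk.filter_mono nhdsWithin_le_nhds, self_mem_nhdsWithin] with x hx hx0
    rw [hx, smul_eq_mul, ← mul_sub, inv_mul_cancel_left₀ (pow_ne_zero _ hx0)]
  · filter_upwards [self_mem_nhdsWithin] with x hx0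
    rw [mul_add, pow_add, inv_mul_cancel_left₀ (pow_ne_zero _ hx0), pow_mul]

theorem exists_analyticAt (hf : HasLogPuiseuxForm f m N ν g) (hm : 0 < m) {t : ℕ → ℂ}
    (hrad : ∀ J : ℕ, (fun u : ℝ => f u - ∑ j ∈ Finset.range J, t j * Complex.exp u ^ j) =O[atBot]
      fun u : ℝ => Complex.exp u ^ J) :
    ∃ h : ℂ → ℂ, AnalyticAt ℂ h 0 ∧
      ∀ᶠ w in comap Complex.re atBot, f w = h (Complex.exp w) := by
  obtain ⟨k, hk, hgk, hkt⟩ := hf.exists_coeff_zero_eq_pow_smul hm hrad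
  obtain ⟨h, hh, hkh⟩ := exists_analyticAt_comp_exp_div hm hk
    (eventually_apply_mul_eq_of_isBigO hm hk hkt (Complex.isPrimitiveRoot_exp m hm.ne').pow_eq_one)
  have hexp := tendsto_exp_div_comap_re_atBot hm
  refine ⟨h, hh, ?_⟩
  filter_upwards [hf.2, hkh, hexp.eventually (hf.eventually_coeff_eq_zero hm hrad),
    hexp.eventually hgk] with w hw hkw hlogw hgw
  have hsum : ∑ β ∈ Finset.range (ν + 1), w ^ β * g β (Complex.exp (w / m)) =
      g 0 (Complex.exp (w / m)) := by
    rw [Finset.sum_range_succ', Finset.sum_eq_zero fun β hβ => ?_, zero_add, pow_zero, one_mul]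
    have hβ' := Nat.succ_lt_succ (Finset.mem_range.1 hβ)
    rw [hlogw _ (Finset.mem_range.2 hβ') β.succ_ne_zero, mul_zero]
  have hpow : Complex.exp (w / m) ^ (m * N) = Complex.exp w ^ N := by
    rw [pow_mul, ← Complex.exp_nat_mul, mul_div_cancel₀ _ (Nat.cast_ne_zero.2 hm.ne')]
  rw [hw, hsum, hgw, hpow, smul_eq_mul, Complex.exp_neg, inv_pow,
    inv_mul_cancel_left₀ (pow_ne_zero _ (Complex.exp_ne_zero _)), hkw]

end HasLogPuiseuxForm

theorem exists_forall_isBigO_sub_sum_pow {g : ℂ → ℂ} (hg : AnalyticAt ℂ g 0) :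
    ∃ c : ℕ → ℂ, ∀ K : ℕ,
      (fun x => g x - ∑ k ∈ Finset.range K, c k * x ^ k) =O[𝓝 0] fun x => x ^ K := by
  obtain ⟨q, hq⟩ := hg
  refine ⟨q.coeff, fun K => ?_⟩
  refine (Asymptotics.isBigO_norm_right.1 ?_)
  simpa [FormalMultilinearSeries.partialSum, FormalMultilinearSeries.apply_eq_pow_smul_coeff,
    mul_comm] using hq.isBigO_sub_partialSum_pow K

theorem LogPuiseuxSeries.partialSum_one_sub_exp (F : LogPuiseuxSeries) (K : ℕ) {w : ℂ}
    (hw : |w.im| < Real.pi) : F.partialSum K (1 - Complex.exp w) =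
      Complex.exp (-w) ^ F.poleOrder * ∑ β ∈ Finset.range (F.logDegree + 1),
        w ^ β * ∑ k ∈ Finset.range K, F.coeff k β * Complex.exp (w / F.ramification) ^ k := by
  have hlog : Complex.log (Complex.exp w) = w :=
    Complex.log_exp (abs_lt.1 hw).1 (abs_lt.1 hw).2.le
  have hpow (k : ℕ) : Complex.exp w ^ (F.exponent k : ℂ) =
      Complex.exp (-w) ^ F.poleOrder * Complex.exp (w / F.ramification) ^ k := by
    rw [Complex.cpow_def_of_ne_zero (Complex.exp_ne_zero w), hlog, ← Complex.exp_nat_mul,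
      ← Complex.exp_nat_mul, ← Complex.exp_add, exponent]
    congr 1
    push_cast
    ring
  simp only [partialSum, logBinom, sub_sub_cancel, hlog, hpow, Finset.mul_sum]
  rw [Finset.sum_comm]
  refine Finset.sum_congr rfl fun β _ => Finset.sum_congr rfl fun k _ => by ring

theorem isBigO_exp_neg_pow_mul_sum_pow_mul {m N ν J K : ℕ} (hm : 0 < m)
    (hK : m * (N + ν + J) ≤ K) {R : ℕ → ℂ → ℂ} (hR : ∀ β, R β =O[𝓝 0] fun x => x ^ K) (M : ℝ) :
    (fun w => Complex.exp (-w) ^ N *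
      ∑ β ∈ Finset.range (ν + 1), w ^ β * R β (Complex.exp (w / m))) =O[leftStrip M]
        fun w => Complex.exp w ^ J := by
  have hRexp (β : ℕ) : (fun w : ℂ => R β (Complex.exp (w / m))) =O[leftStrip M]
      fun w => Complex.exp w ^ (N + ν + J) := by
    refine (((hR β).trans (isBigO_pow_pow_nhds_zero hK)).comp_tendsto
      ((tendsto_exp_div_comap_re_atBot hm).mono_left inf_le_left)).congr_right fun w => ?_
    rw [Function.comp_apply, pow_mul, ← Complex.exp_nat_mul,
      mul_div_cancel₀ _ (Nat.cast_ne_zero.2 hm.ne')]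
  have hterm : ∀ β ∈ Finset.range (ν + 1), (fun w => w ^ β * R β (Complex.exp (w / m)))
      =O[leftStrip M] fun w => Complex.exp (-w) ^ ν * Complex.exp w ^ (N + ν + J) := fun β hβ =>
    (((isBigO_id_exp_neg M).pow β).trans
      (isBigO_exp_neg_pow_of_le (Nat.lt_succ_iff.1 (Finset.mem_range.1 hβ)) M)).mul (hRexp β)
  refine ((Asymptotics.isBigO_refl _ _).mul (.fun_sum hterm)).congr_right fun w => ?_
  rw [← mul_assoc, ← pow_add, add_comm N, pow_add _ (_ + _), ← mul_assoc, ← mul_pow,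
    ← Complex.exp_add, neg_add_cancel, Complex.exp_zero, one_pow, one_mul]

theorem abs_im_log_lt_pi {z : ℂ} (hz : z ∈ Complex.slitPlane) :
    |(Complex.log z).im| < Real.pi := by
  rw [Complex.log_im, abs_lt]
  exact ⟨Complex.neg_pi_lt_arg z,
    (Complex.arg_le_pi z).lt_of_ne (Complex.mem_slitPlane_iff_arg.1 hz).1⟩

/-- The plane slit along the ray `{t p : t ≥ 1}`, for `p ≠ 0`. -/
def slitPlaneAt (p : ℂ) : Set ℂ :=
  {z | 1 - z / p ∈ Complex.slitPlane}

theorem tendsto_log_one_sub_div {p : ℂ} (hp : p ≠ 0) :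
    Tendsto (fun z => Complex.log (1 - z / p)) (𝓝[slitPlaneAt p] p)
      (leftStrip Real.pi) := by
  refine tendsto_inf.2 ⟨tendsto_comap_iff.2 ?_, tendsto_principal.2 ?_⟩
  · have hcont : Tendsto (fun z => ‖1 - z / p‖) (𝓝 p) (𝓝 0) :=
      Continuous.tendsto' (by fun_prop) _ _ (by simp [hp])
    refine (Real.tendsto_log_nhdsNE_zero.comp (tendsto_nhdsWithin_iff.2
      ⟨hcont.mono_left nhdsWithin_le_nhds, ?_⟩)).congr fun z => (Complex.log_re _).symm
    filter_upwards [self_mem_nhdsWithin] with z hz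
    exact norm_ne_zero_iff.2 (Complex.slitPlane_ne_zero hz)
  · exact eventually_mem_nhdsWithin.mono fun z hz => (abs_im_log_lt_pi hz).le

/-- `F (1 - z / p)` is an asymptotic expansion of `G z` at `p`, in the plane slit at `p`. -/
def HasLogPuiseuxExpansionAt (G : ℂ → ℂ) (p : ℂ) (F : LogPuiseuxSeries) : Prop :=
  ∀ J : ℕ, ∀ᶠ K in atTop, (fun z => G z - F.partialSum K (z / p))
    =O[𝓝[slitPlaneAt p] p] fun z => (z - p) ^ J

theorem HasQuasiUnipotentMonodromyAt.exists_hasLogPuiseuxExpansionAt {G : ℂ → ℂ} {p : ℂ}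
    (hp : p ≠ 0) (h : HasQuasiUnipotentMonodromyAt G p) :
    ∃ F, HasLogPuiseuxExpansionAt G p F := by
  obtain ⟨m, N, ν, g, f, hm, ⟨hg, hf⟩, hfG⟩ := h.exists_hasLogPuiseuxForm
  choose c hc using fun β => exists_forall_isBigO_sub_sum_pow (hg β)
  refine ⟨⟨m, hm, N, ν, fun k β => c β k⟩, fun J => ?_⟩
  filter_upwards [eventually_ge_atTop (m * (N + ν + J))] with K hK
  have hO := (isBigO_exp_neg_pow_mul_sum_pow_mul hm hK (fun β => hc β K) Real.pi).comp_tendsto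
    (tendsto_log_one_sub_div hp)
  have hpow : (fun z => (1 - z / p) ^ J) =O[𝓝[slitPlaneAt p] p]
      fun z => (z - p) ^ J := by
    refine .pow (.of_bound ‖p⁻¹‖ (.of_forall fun z => ?_)) J
    rw [← norm_mul, ← norm_neg, neg_sub, inv_mul_eq_div, sub_div, div_self hp]
  refine (hO.congr' ?_ ?_).trans hpow
  · have hlog := (tendsto_log_one_sub_div hp).mono_right inf_le_left
    filter_upwards [hlog.eventually hf, hlog.eventually hfG, self_mem_nhdsWithin] with z hfz hGz hz
    have hexp := Complex.exp_log (Complex.slitPlane_ne_zero hz)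
    have hzp : z / p = 1 - Complex.exp (Complex.log (1 - z / p)) := by rw [hexp, sub_sub_cancel]
    have hGz' := hGz (abs_im_log_lt_pi hz)
    rw [← hzp, mul_div_cancel₀ _ hp] at hGz'
    rw [← hGz', hfz, hzp, LogPuiseuxSeries.partialSum_one_sub_exp _ _ (abs_im_log_lt_pi hz), ← hzp]
    simp only [Function.comp_apply, mul_sub, Finset.sum_sub_distrib]
  · filter_upwards [self_mem_nhdsWithin] with z hz
    rw [Function.comp_apply, Complex.exp_log (Complex.slitPlane_ne_zero hz)]

/-! ### From local expansions to coefficients -/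

theorem one_sub_mem_slitPlane_iff {z : ℂ} :
    1 - z ∈ Complex.slitPlane ↔ ∀ t : ℝ, 1 ≤ t → z ≠ t := by
  have h : 1 - z ∉ Complex.slitPlane ↔ 1 ≤ z.re ∧ z.im = 0 := by
    simp [Complex.mem_slitPlane_iff]
  rw [← not_iff_not, h]
  push Not
  refine ⟨fun hz => ⟨z.re, hz.1, Complex.ext rfl hz.2⟩, ?_⟩
  rintro ⟨t, ht, rfl⟩
  exact ⟨ht, Complex.ofReal_im t⟩

theorem mem_slitPlaneAt_iff {p z : ℂ} (hp : p ≠ 0) :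
    z ∈ slitPlaneAt p ↔ ∀ t : ℝ, 1 ≤ t → z ≠ t * p := by
  simp only [slitPlaneAt, Set.mem_ofPred_eq, one_sub_mem_slitPlane_iff, ne_eq, div_eq_iff hp]

theorem isOpen_slitPlaneAt (p : ℂ) : IsOpen (slitPlaneAt p) :=
  Complex.isOpen_slitPlane.preimage (by fun_prop)

theorem mem_slitPlaneAt_of_norm_le {p z : ℂ} (hp : p ≠ 0) (hz : ‖z‖ ≤ ‖p‖) (hne : z ≠ p) :
    z ∈ slitPlaneAt p := by
  rw [mem_slitPlaneAt_iff hp]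
  rintro t ht rfl
  rw [norm_mul, Complex.norm_of_nonneg (zero_le_one.trans ht),
    mul_le_iff_le_one_left (norm_pos_iff.2 hp)] at hz
  exact hne (by rw [hz.antisymm ht, Complex.ofReal_one, one_mul])

theorem ball_subset_slitPlaneAt (p : ℂ) : Metric.ball 0 ‖p‖ ⊆ slitPlaneAt p := fun z hz => by
  have hz : ‖z‖ < ‖p‖ := mem_ball_zero_iff.1 hz
  exact mem_slitPlaneAt_of_norm_le (norm_pos_iff.1 ((norm_nonneg z).trans_lt hz)) hz.le
    (ne_of_apply_ne norm hz.ne)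

section SlitDisk

variable {r ε : ℝ} {L : Finset ℂ}

theorem slitDisk_eq_inter_iInter (hL : ∀ p ∈ L, p ≠ 0) :
    slitDisk r ε L = Metric.ball 0 (r + ε) ∩ ⋂ p ∈ L, slitPlaneAt p := by
  ext z
  simp only [slitDisk, Set.mem_ofPred_eq, Set.mem_inter_iff, mem_ball_zero_iff, Set.mem_iInter]
  exact and_congr_right fun _ => forall₂_congr fun p hp => (mem_slitPlaneAt_iff (hL p hp)).symm

theorem isOpen_slitDisk (hL : ∀ p ∈ L, p ≠ 0) : IsOpen (slitDisk r ε L) := by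
  rw [slitDisk_eq_inter_iInter hL]
  exact Metric.isOpen_ball.inter (isOpen_biInter_finset fun p _ => isOpen_slitPlaneAt p)

theorem slitDisk_subset_slitPlaneAt {p : ℂ} (hp : p ∈ L) (hp0 : p ≠ 0) :
    slitDisk r ε L ⊆ slitPlaneAt p := fun _ hz =>
  (mem_slitPlaneAt_iff hp0).2 (hz.2 p hp)

theorem ne_zero_of_forall_norm_eq (hr : 0 < r) (hL : ∀ p ∈ L, ‖p‖ = r) : ∀ p ∈ L, p ≠ 0 :=
  fun p hp => norm_pos_iff.1 (hL p hp ▸ hr)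

theorem mem_slitDisk_of_norm_le (hr : 0 < r) (hε : 0 < ε) (hL : ∀ p ∈ L, ‖p‖ = r) {z : ℂ}
    (hz : ‖z‖ ≤ r) (hzL : z ∉ L) : z ∈ slitDisk r ε L := by
  have hL0 := ne_zero_of_forall_norm_eq hr hL
  rw [slitDisk_eq_inter_iInter hL0]
  refine ⟨mem_ball_zero_iff.2 (by linarith), Set.mem_iInter₂.2 fun p hp => ?_⟩
  exact mem_slitPlaneAt_of_norm_le (hL0 p hp) (hz.trans (hL p hp).ge)
    (ne_of_mem_of_not_mem hp hzL).symm

theorem ball_subset_slitDisk (hr : 0 < r) (hε : 0 < ε) (hL : ∀ p ∈ L, ‖p‖ = r) :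
    Metric.ball 0 r ⊆ slitDisk r ε L := fun z hz => by
  have hz : ‖z‖ < r := mem_ball_zero_iff.1 hz
  exact mem_slitDisk_of_norm_le hr hε hL hz.le fun hzL => hz.ne (hL z hzL)

theorem slitDisk_mem_nhdsWithin (hr : 0 < r) (hε : 0 < ε) (hL : ∀ p ∈ L, ‖p‖ = r) {p : ℂ}
    (hp : p ∈ L) : slitDisk r ε L ∈ 𝓝[slitPlaneAt p] p := by
  have hL' : ∀ q ∈ L.erase p, ‖q‖ = r := fun q hq => hL q (Finset.mem_of_mem_erase hq)
  have hmem : p ∈ slitDisk r ε (L.erase p) :=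
    mem_slitDisk_of_norm_le hr hε hL' (hL p hp).le (L.notMem_erase p)
  have hnhds := (isOpen_slitDisk (ne_zero_of_forall_norm_eq hr hL')).mem_nhds hmem
  filter_upwards [self_mem_nhdsWithin, mem_nhdsWithin_of_mem_nhds hnhds] with z hzp hz
  refine ⟨hz.1, fun q hq => ?_⟩
  rcases eq_or_ne q p with rfl | hqp
  · exact (mem_slitPlaneAt_iff (ne_zero_of_forall_norm_eq hr hL q hq)).1 hzp
  · exact hz.2 q (Finset.mem_erase.2 ⟨hqp, hq⟩)

end SlitDisk

theorem add_mem_slitPlane {z w : ℂ} (hz : 0 < z.re) (hw : ‖w‖ < ‖z‖) :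
    z + w ∈ Complex.slitPlane := by
  by_contra h
  simp only [Complex.mem_slitPlane_iff, Complex.add_re, Complex.add_im, not_or, not_lt,
    not_not] at h
  have him : w.im ^ 2 = z.im ^ 2 := by rw [eq_neg_of_add_eq_zero_right h.2, neg_sq]
  have hre : z.re ^ 2 ≤ w.re ^ 2 :=
    neg_sq w.re ▸ pow_le_pow_left₀ hz.le (le_neg_iff_add_nonpos_right.2 h.1) 2
  refine hw.not_ge ?_
  rw [Complex.norm_eq_sqrt_sq_add_sq, Complex.norm_eq_sqrt_sq_add_sq, him]
  gcongr

theorem mem_slitPlaneAt_of_dist_lt {p y z : ℂ} (hz : ‖z‖ < ‖p‖) (hy : dist y z < dist z p) :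
    y ∈ slitPlaneAt p := by
  have hp : p ≠ 0 := norm_pos_iff.1 ((norm_nonneg z).trans_lt hz)
  have hp' : 0 < ‖p‖ := norm_pos_iff.2 hp
  have hre : 0 < (1 - z / p).re := by
    have : (z / p).re < 1 := (Complex.re_le_norm _).trans_lt (by rwa [norm_div, div_lt_one hp'])
    simpa using this
  have hnorm : ‖(z - y) / p‖ < ‖1 - z / p‖ := by
    rw [one_sub_div hp, norm_div, norm_div, ← dist_eq_norm, ← dist_eq_norm, dist_comm, dist_comm p]
    gcongr
  simpa only [slitPlaneAt, Set.mem_ofPred_eq, sub_div, sub_add_sub_cancel]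
    using add_mem_slitPlane hre hnorm

theorem isBigO_iteratedDeriv_of_isBigO_pow {F : ℂ → ℂ} {p : ℂ} {J : ℕ}
    (hd : ∀ᶠ z in 𝓝[slitPlaneAt p] p, DifferentiableAt ℂ F z)
    (hF : F =O[𝓝[slitPlaneAt p] p] fun z => (z - p) ^ J) :
    iteratedDeriv J F =O[𝓝[Metric.ball 0 ‖p‖] p] fun _ => (1 : ℝ) := by
  obtain ⟨C, hC0, hC⟩ := hF.exists_nonneg
  obtain ⟨δ, hδ, hball⟩ := Metric.mem_nhdsWithin_iff.1 (hd.and hC.bound)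
  refine .of_bound (J.factorial * C * 3 ^ J) ?_
  filter_upwards [self_mem_nhdsWithin, mem_nhdsWithin_of_mem_nhds (Metric.ball_mem_nhds p
    (half_pos hδ))] with z hz hzδ
  have hz : ‖z‖ < ‖p‖ := mem_ball_zero_iff.1 hz
  have hzδ : dist z p < δ / 2 := hzδ
  have hzp : 0 < dist z p := dist_pos.2 (ne_of_apply_ne norm hz.ne)
  set R := dist z p / 2 with hR
  have hR0 : 0 < R := half_pos hzp
  have hcb : ∀ y ∈ Metric.closedBall z R,
      dist y p ≤ 3 * R ∧ DifferentiableAt ℂ F y ∧ ‖F y‖ ≤ C * ‖(y - p) ^ J‖ := fun y hy => by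
    have hy : dist y z ≤ R := hy
    have hyp : dist y p ≤ 3 * R := (dist_triangle y z p).trans (by linarith)
    exact ⟨hyp, hball ⟨hyp.trans_lt (by linarith),
      mem_slitPlaneAt_of_dist_lt hz (by linarith)⟩⟩
  have hdiff : DifferentiableOn ℂ F (Metric.closedBall z R) := fun y hy =>
    (hcb y hy).2.1.differentiableWithinAt
  have hsphere : ∀ y ∈ Metric.sphere z R, ‖F y‖ ≤ C * (3 * R) ^ J := fun y hy => by
    obtain ⟨hyp, -, hFy⟩ := hcb y (Metric.sphere_subset_closedBall hy)
    refine hFy.trans ?_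
    rw [norm_pow, ← dist_eq_norm]
    gcongr
  calc ‖iteratedDeriv J F z‖ ≤ J.factorial * (C * (3 * R) ^ J) / R ^ J :=
        Complex.norm_iteratedDeriv_le_of_forall_mem_sphere_norm_le J hR0
          (hdiff.diffContOnCl_ball le_rfl) hsphere
    _ = J.factorial * C * 3 ^ J * ‖(1 : ℝ)‖ := by
        rw [mul_pow, norm_one]
        field_simp

theorem isBigO_principal_inter_of_isCompact {X E F : Type*} [TopologicalSpace X]
    [SeminormedAddCommGroup E] [SeminormedAddCommGroup F] {K s : Set X} (hK : IsCompact K)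
    {f : X → E} {g : X → F} (hf : ∀ x ∈ K, f =O[𝓝[s] x] g) : f =O[𝓟 (K ∩ s)] g := by
  refine hK.induction_on (p := fun t => f =O[𝓟 (t ∩ s)] g) ?_ ?_ ?_ ?_
  · rw [Set.empty_inter, principal_empty]
    exact .of_bound 0 eventually_bot
  · exact fun t u htu hu => hu.mono (principal_mono.2 (Set.inter_subset_inter_left s htu))
  · intro t u ht hu
    rw [Set.union_inter_distrib_right, ← sup_principal]
    exact ht.sup hu
  · intro x hx
    obtain ⟨C, hC⟩ := (hf x hx).bound
    exact ⟨_, mem_nhdsWithin_of_mem_nhds (eventually_nhdsWithin_iff.1 hC),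
      .of_bound C (eventually_principal.2 fun y hy => hy.1 hy.2)⟩

theorem iteratedDeriv_zero_eq_of_hasSum {b : ℕ → ℂ} {R : ℂ → ℂ}
    (h : ∀ᶠ z in 𝓝 (0 : ℂ), HasSum (fun n => b n * z ^ n) (R z)) (n : ℕ) :
    iteratedDeriv n R 0 = n.factorial * b n := by
  have hR : HasFPowerSeriesAt R (.ofScalars ℂ b) 0 := by
    rw [hasFPowerSeriesAt_iff]
    simpa only [FormalMultilinearSeries.coeff_ofScalars, zero_add, smul_eq_mul, mul_comm] using h
  have hcoeff := congrArg (fun q => q.coeff n)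
    (hR.eq_formalMultilinearSeries hR.analyticAt.hasFPowerSeriesAt)
  simp only [FormalMultilinearSeries.coeff_ofScalars] at hcoeff
  rw [hcoeff, mul_div_cancel₀ _ (Nat.cast_ne_zero.2 n.factorial_ne_zero)]

theorem norm_iteratedDeriv_le_of_forall_mem_ball {F : ℂ → ℂ} {c : ℂ} {r C : ℝ} (hr : 0 < r)
    (hF : DifferentiableOn ℂ F (Metric.ball c r)) (hC : ∀ z ∈ Metric.ball c r, ‖F z‖ ≤ C)
    (n : ℕ) : ‖iteratedDeriv n F c‖ ≤ n.factorial * C / r ^ n := by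
  have hlim : Tendsto (fun ρ : ℝ => n.factorial * C / ρ ^ n) (𝓝[<] r)
      (𝓝 (n.factorial * C / r ^ n)) := by
    have : ContinuousAt (fun ρ : ℝ => n.factorial * C / ρ ^ n) r :=
      continuousAt_const.div (by fun_prop) (pow_ne_zero n hr.ne')
    exact this.tendsto.mono_left nhdsWithin_le_nhds
  refine ge_of_tendsto hlim ?_
  filter_upwards [Ioo_mem_nhdsLT hr] with ρ hρ
  have hsub : Metric.closedBall c ρ ⊆ Metric.ball c r := Metric.closedBall_subset_ball hρ.2
  exact Complex.norm_iteratedDeriv_le_of_forall_mem_sphere_norm_le n hρ.1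
    ((hF.mono hsub).diffContOnCl_ball le_rfl)
    fun z hz => hC z (hsub (Metric.sphere_subset_closedBall hz))

theorem isBigO_coeff_of_isBigO_iteratedDeriv {b : ℕ → ℂ} {R : ℂ → ℂ} {r : ℝ} (hr : 0 < r)
    (hb : ∀ᶠ z in 𝓝 (0 : ℂ), HasSum (fun n => b n * z ^ n) (R z))
    (hR : DifferentiableOn ℂ R (Metric.ball 0 r)) {J : ℕ}
    (hJ : iteratedDeriv J R =O[𝓟 (Metric.ball 0 r)] fun _ => (1 : ℝ)) :
    (fun n => b n * (r : ℂ) ^ n) =O[atTop] fun n : ℕ => ((n : ℝ) ^ J)⁻¹ := by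
  obtain ⟨C, hC⟩ := hJ.bound
  simp only [eventually_principal, norm_one, mul_one] at hC
  have hd : DifferentiableOn ℂ (iteratedDeriv J R) (Metric.ball 0 r) := fun z hz => by
    rw [iteratedDeriv_eq_iterate]
    exact ((hR.analyticAt (Metric.isOpen_ball.mem_nhds hz)).iterated_deriv
      J).differentiableAt.differentiableWithinAt
  have hcauchy (n : ℕ) : ‖((n + J).factorial : ℂ) * b (n + J)‖ ≤ n.factorial * C / r ^ n := by
    have h := norm_iteratedDeriv_le_of_forall_mem_ball hr hd hC n
    rwa [iteratedDeriv_eq_iterate, iteratedDeriv_eq_iterate, ← Function.iterate_add_apply,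
      ← iteratedDeriv_eq_iterate, iteratedDeriv_zero_eq_of_hasSum hb] at h
  have hdesc : (fun n => b n * (r : ℂ) ^ n) =O[atTop] fun n : ℕ => ((n.descFactorial J : ℝ))⁻¹ := by
    refine .of_bound (C * r ^ J) ?_
    filter_upwards [eventually_ge_atTop J] with n hn
    obtain ⟨k, rfl⟩ := Nat.exists_eq_add_of_le' hn
    have hfac : (k.factorial : ℝ) * (k + J).descFactorial J = (k + J).factorial := by
      exact_mod_cast Nat.add_sub_cancel k J ▸ Nat.factorial_mul_descFactorial hn
    have hdesc0 : (0 : ℝ) < (k + J).descFactorial J :=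
      Nat.cast_pos.2 (Nat.descFactorial_pos.2 hn)
    have hk := hcauchy k
    rw [norm_mul, Complex.norm_natCast, ← hfac, mul_assoc, mul_div_assoc,
      mul_le_mul_iff_right₀ (Nat.cast_pos.2 k.factorial_pos), le_div_iff₀ (pow_pos hr k)] at hk
    rw [norm_mul, norm_pow, Complex.norm_of_nonneg hr.le, norm_inv,
      Real.norm_of_nonneg hdesc0.le, ← div_eq_mul_inv, le_div_iff₀ hdesc0, pow_add]
    calc ‖b (k + J)‖ * (r ^ k * r ^ J) * (k + J).descFactorial J
        = (k + J).descFactorial J * ‖b (k + J)‖ * r ^ k * r ^ J := by ring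
      _ ≤ C * r ^ J := by gcongr
  exact hdesc.trans (isEquivalent_descFactorial J).inv.isBigO

theorem isBigO_iteratedDeriv_of_analyticAt {F : ℂ → ℂ} {z : ℂ} (hF : AnalyticAt ℂ F z) (n : ℕ) :
    iteratedDeriv n F =O[𝓝 z] fun _ => (1 : ℝ) := by
  rw [iteratedDeriv_eq_iterate]
  exact (hF.iterated_deriv n).continuousAt.tendsto.isBigO_one ℝ

theorem isBigO_iteratedDeriv_of_isBigO_sub {R A : ℂ → ℂ} {p : ℂ} {J : ℕ}
    (hR : ∀ᶠ z in 𝓝[slitPlaneAt p] p, AnalyticAt ℂ R z) (hA : AnalyticAt ℂ A p)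
    (hRA : (R - A) =O[𝓝[slitPlaneAt p] p] fun z => (z - p) ^ J) :
    iteratedDeriv J R =O[𝓝[Metric.ball 0 ‖p‖] p] fun _ => (1 : ℝ) := by
  have hA' : ∀ᶠ z in 𝓝[slitPlaneAt p] p, AnalyticAt ℂ A z :=
    hA.eventually_analyticAt.filter_mono nhdsWithin_le_nhds
  have hsub : iteratedDeriv J (R - A) =O[𝓝[Metric.ball 0 ‖p‖] p] fun _ => (1 : ℝ) :=
    isBigO_iteratedDeriv_of_isBigO_pow
      ((hR.and hA').mono fun z hz => (hz.1.sub hz.2).differentiableAt) hRA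
  refine (hsub.add ((isBigO_iteratedDeriv_of_analyticAt hA J).mono nhdsWithin_le_nhds)).congr' ?_
    .rfl
  filter_upwards [(hR.and hA').filter_mono (nhdsWithin_mono p (ball_subset_slitPlaneAt p))]
    with z hz
  rw [iteratedDeriv_sub hz.1.contDiffAt hz.2.contDiffAt, sub_add_cancel]

theorem isBigO_coeff_of_isBigO_sub {b : ℕ → ℂ} {R : ℂ → ℂ} {r ε : ℝ} (hr : 0 < r) (hε : 0 < ε)
    {L : Finset ℂ} (hL : ∀ p ∈ L, ‖p‖ = r)
    (hb : ∀ᶠ z in 𝓝 (0 : ℂ), HasSum (fun n => b n * z ^ n) (R z))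
    (hR : DifferentiableOn ℂ R (slitDisk r ε L)) {J : ℕ}
    (hloc : ∀ p ∈ L, ∃ A : ℂ → ℂ, AnalyticAt ℂ A p ∧
      (R - A) =O[𝓝[slitPlaneAt p] p] fun z => (z - p) ^ J) :
    (fun n => b n * (r : ℂ) ^ n) =O[atTop] fun n : ℕ => ((n : ℝ) ^ J)⁻¹ := by
  have hRan : ∀ z ∈ slitDisk r ε L, AnalyticAt ℂ R z := fun z hz =>
    hR.analyticAt ((isOpen_slitDisk (ne_zero_of_forall_norm_eq hr hL)).mem_nhds hz)
  refine isBigO_coeff_of_isBigO_iteratedDeriv hr hb (hR.mono (ball_subset_slitDisk hr hε hL)) ?_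
  rw [← Set.inter_eq_self_of_subset_right Metric.ball_subset_closedBall]
  refine isBigO_principal_inter_of_isCompact (isCompact_closedBall 0 r) fun p hpr => ?_
  by_cases hp : p ∈ L
  · obtain ⟨A, hA, hRA⟩ := hloc p hp
    have hRp := mem_of_superset (slitDisk_mem_nhdsWithin hr hε hL hp) hRan
    exact hL p hp ▸ isBigO_iteratedDeriv_of_isBigO_sub hRp hA hRA
  · have hpS := mem_slitDisk_of_norm_le hr hε hL (mem_closedBall_zero_iff.1 hpr) hp
    exact (isBigO_iteratedDeriv_of_analyticAt (hRan p hpS) J).mono nhdsWithin_le_nhds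

theorem one_sub_pow_succ_sub_sum {A : Type*} [CommRing A] (x : A) (n J : ℕ) :
    (1 - x) ^ (n + 1) - ∑ j ∈ Finset.range (J + 1), ((n + 1).choose j : A) * (-x) ^ j =
      ((1 - x) ^ n - ∑ j ∈ Finset.range (J + 1), (n.choose j : A) * (-x) ^ j) -
        x * ((1 - x) ^ n - ∑ j ∈ Finset.range J, (n.choose j : A) * (-x) ^ j) := by
  have hpascal : ∑ j ∈ Finset.range (J + 1), ((n + 1).choose j : A) * (-x) ^ j =
      ∑ j ∈ Finset.range (J + 1), (n.choose j : A) * (-x) ^ j -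
        x * ∑ j ∈ Finset.range J, (n.choose j : A) * (-x) ^ j := by
    simp only [Finset.sum_range_succ' _ J, Nat.choose_succ_succ, Nat.cast_add, add_mul,
      Finset.sum_add_distrib, Finset.mul_sum, Nat.choose_zero_right, pow_succ, mul_neg,
      Finset.sum_neg_distrib]
    simp only [mul_left_comm x, mul_comm x]
    ring
  rw [hpascal]
  ring

theorem abs_one_sub_pow_sub_sum_le {x : ℝ} (h0 : 0 ≤ x) (h1 : x ≤ 1) (n J : ℕ) :
    |(1 - x) ^ n - ∑ j ∈ Finset.range J, (n.choose j : ℝ) * (-x) ^ j| ≤ n.choose J * x ^ J := by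
  induction n generalizing J with
  | zero => cases J <;> simp [Finset.sum_range_succ']
  | succ n ih =>
    cases J with
    | zero =>
      simpa [abs_of_nonneg (sub_nonneg.2 h1)] using
        pow_le_one₀ (n := n + 1) (sub_nonneg.2 h1) (sub_le_self 1 h0)
    | succ J =>
      rw [one_sub_pow_succ_sub_sum]
      refine (abs_sub _ _).trans ?_
      rw [abs_mul, abs_of_nonneg h0]
      calc _ ≤ n.choose (J + 1) * x ^ (J + 1) + x * (n.choose J * x ^ J) := by
            gcongr
            exacts [ih (J + 1), ih J]
        _ = (n + 1).choose (J + 1) * x ^ (J + 1) := by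
            rw [Nat.choose_succ_succ]
            push_cast
            ring

theorem summable_norm_mul_choose {b : ℕ → ℂ}
    (hb : ∀ J : ℕ, b =O[atTop] fun n : ℕ => ((n : ℝ) ^ J)⁻¹) (J : ℕ) :
    Summable fun n => ‖b n‖ * (n.choose J : ℝ) := by
  refine summable_of_isBigO_nat (Real.summable_nat_pow_inv.2 one_lt_two) ?_
  have hchoose : (fun n : ℕ => (n.choose J : ℝ)) =O[atTop] fun n : ℕ => (n : ℝ) ^ J :=
    .of_bound 1 (.of_forall fun n => by
      rw [Real.norm_natCast, norm_pow, Real.norm_natCast, one_mul]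
      exact_mod_cast n.choose_le_pow J)
  refine ((hb (J + 2)).norm_left.mul hchoose).congr' .rfl ?_
  filter_upwards [eventually_gt_atTop 0] with n hn
  have hn0 : (n : ℝ) ≠ 0 := Nat.cast_ne_zero.2 hn.ne'
  field_simp
  rw [← pow_add]

theorem exists_isBigO_sub_sum_pow_of_hasSum {b : ℕ → ℂ}
    (hb : ∀ J : ℕ, b =O[atTop] fun n : ℕ => ((n : ℝ) ^ J)⁻¹) {f : ℝ → ℂ}
    (hf : ∀ᶠ x : ℝ in 𝓝[>] 0, HasSum (fun n => b n * (1 - (x : ℂ)) ^ n) (f x)) :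
    ∃ t : ℕ → ℂ, ∀ J : ℕ, (fun x : ℝ => f x - ∑ j ∈ Finset.range J, t j * (x : ℂ) ^ j)
      =O[𝓝[>] 0] fun x => (x : ℂ) ^ J := by
  have hsum (j : ℕ) : Summable fun n => b n * ((n.choose j : ℂ) * (-1) ^ j) :=
    .of_norm (by simpa using summable_norm_mul_choose hb j)
  refine ⟨fun j => ∑' n, b n * ((n.choose j : ℂ) * (-1) ^ j), fun J => ?_⟩
  refine .of_bound (∑' n, ‖b n‖ * (n.choose J : ℝ)) ?_
  filter_upwards [hf, Ioo_mem_nhdsGT one_pos] with x hx hx01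
  have hrem := hx.sub (hasSum_sum fun j (_ : j ∈ Finset.range J) =>
    (hsum j).hasSum.mul_right ((x : ℂ) ^ j))
  rw [← hrem.tsum_eq, norm_pow, Complex.norm_of_nonneg hx01.1.le]
  refine tsum_of_norm_bounded
    ((summable_norm_mul_choose hb J).hasSum.mul_right (x ^ J)) fun n => ?_
  have hfactor : b n * (1 - x) ^ n -
      ∑ j ∈ Finset.range J, b n * ((n.choose j : ℂ) * (-1) ^ j) * (x : ℂ) ^ j =
      b n * (((1 - x) ^ n - ∑ j ∈ Finset.range J, (n.choose j : ℝ) * (-x) ^ j : ℝ) : ℂ) := by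
    push_cast
    rw [mul_sub, Finset.mul_sum]
    refine congrArg _ (Finset.sum_congr rfl fun j _ => ?_)
    rw [neg_pow (x : ℂ)]
    ring
  rw [hfactor, norm_mul, Complex.norm_real, mul_assoc]
  exact mul_le_mul_of_nonneg_left (abs_one_sub_pow_sub_sum_le hx01.1.le hx01.2.le n J)
    (norm_nonneg _)

theorem hasSum_of_differentiableOn_ball {a : ℕ → ℂ} {G : ℂ → ℂ} {r : ℝ}
    (hGa : ∀ᶠ z in 𝓝 (0 : ℂ), HasSum (fun n => a n * z ^ n) (G z))
    (hG : DifferentiableOn ℂ G (Metric.ball 0 r)) {z : ℂ} (hz : z ∈ Metric.ball 0 r) :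
    HasSum (fun n => a n * z ^ n) (G z) := by
  refine (Complex.hasSum_taylorSeries_on_ball hG hz).congr_fun fun n => ?_
  rw [iteratedDeriv_zero_eq_of_hasSum hGa, sub_zero, smul_eq_mul, smul_eq_mul, mul_left_comm,
    inv_mul_cancel_left₀ (Nat.cast_ne_zero.2 n.factorial_ne_zero), mul_comm]

theorem exists_isBigO_radial_sub_sum_pow {a : ℕ → ℂ} {G : ℂ → ℂ} {p : ℂ} (hp : p ≠ 0)
    (hGa : ∀ᶠ z in 𝓝 (0 : ℂ), HasSum (fun n => a n * z ^ n) (G z))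
    (hG : DifferentiableOn ℂ G (Metric.ball 0 ‖p‖))
    (ha : ∀ J : ℕ, (fun n => a n * (‖p‖ : ℂ) ^ n) =O[atTop] fun n : ℕ => ((n : ℝ) ^ J)⁻¹) :
    ∃ t : ℕ → ℂ, ∀ J : ℕ, (fun x : ℝ => G (p * (1 - x)) -
      ∑ j ∈ Finset.range J, t j * (x : ℂ) ^ j) =O[𝓝[>] 0] fun x => (x : ℂ) ^ J := by
  refine exists_isBigO_sub_sum_pow_of_hasSum (b := fun n => a n * p ^ n) (fun J => ?_) ?_
  · refine Asymptotics.isBigO_norm_left.1 ((ha J).norm_left.congr_left fun n => ?_)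
    simp only [norm_mul, norm_pow, Complex.norm_real, norm_norm]
  · filter_upwards [Ioo_mem_nhdsGT one_pos] with x hx
    have hz : p * (1 - x) ∈ Metric.ball 0 ‖p‖ := by
      rw [mem_ball_zero_iff, norm_mul, ← Complex.ofReal_one, ← Complex.ofReal_sub,
        Complex.norm_of_nonneg (sub_nonneg.2 hx.2.le)]
      exact mul_lt_of_lt_one_right (norm_pos_iff.2 hp) (sub_lt_self 1 hx.1)
    simpa only [mul_pow, mul_assoc] using hasSum_of_differentiableOn_ball hGa hG hz

theorem HasQuasiUnipotentMonodromyAt.not_isSingularBoundaryPoint {a : ℕ → ℂ} {G : ℂ → ℂ} {p : ℂ}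
    (h : HasQuasiUnipotentMonodromyAt G p) (hp : p ≠ 0)
    (hGa : ∀ᶠ z in 𝓝 (0 : ℂ), HasSum (fun n => a n * z ^ n) (G z))
    (hG : DifferentiableOn ℂ G (Metric.ball 0 ‖p‖))
    (ha : ∀ J : ℕ, (fun n => a n * (‖p‖ : ℂ) ^ n) =O[atTop] fun n : ℕ => ((n : ℝ) ^ J)⁻¹) :
    ¬IsSingularBoundaryPoint G ‖p‖ p := by
  obtain ⟨m, N, ν, g, f, hm, hf, hfG⟩ := h.exists_hasLogPuiseuxForm
  obtain ⟨t, ht⟩ := exists_isBigO_radial_sub_sum_pow hp hGa hG ha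
  have hrad (J : ℕ) : (fun u : ℝ => f u - ∑ j ∈ Finset.range J, t j * Complex.exp u ^ j)
      =O[atBot] fun u : ℝ => Complex.exp u ^ J := by
    refine ((ht J).comp_tendsto Real.tendsto_exp_atBot_nhdsGT).congr' ?_
      (.of_forall fun u => by simp only [Function.comp_apply, Complex.ofReal_exp])
    have hleft : Tendsto (fun u : ℝ => (u : ℂ)) atBot (comap Complex.re atBot) :=
      tendsto_comap_iff.2 tendsto_id
    filter_upwards [hleft.eventually hfG] with u hu
    simp only [Function.comp_apply, Complex.ofReal_exp,
      hu (by simpa only [Complex.ofReal_im, abs_zero] using Real.pi_pos)]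
  obtain ⟨k, hk, hfk⟩ := hf.exists_analyticAt hm hrad
  refine not_not.2 ⟨fun z => k (1 - z / p), ?_, ?_⟩
  · exact AnalyticAt.fun_comp (by simpa only [div_self hp, sub_self] using hk) (by fun_prop)
  · refine Eventually.filter_mono (nhdsWithin_mono p (ball_subset_slitPlaneAt p)) ?_
    have hlog := (tendsto_log_one_sub_div hp).mono_right inf_le_left
    filter_upwards [hlog.eventually hfk, hlog.eventually hfG, self_mem_nhdsWithin]
      with z hkz hGz hz
    rw [hGz (abs_im_log_lt_pi hz), Complex.exp_log (Complex.slitPlane_ne_zero hz), sub_sub_cancel,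
      mul_div_cancel₀ _ hp] at hkz
    exact hkz

theorem isBigO_sub_sum_partialSumCoeff {a : ℕ → ℂ} {G : ℂ → ℂ} {r ε : ℝ} (hr : 0 < r) (hε : 0 < ε)
    {L : Finset ℂ} (hL : ∀ p ∈ L, ‖p‖ = r)
    (hGa : ∀ᶠ z in 𝓝 (0 : ℂ), HasSum (fun n => a n * z ^ n) (G z))
    (hG : DifferentiableOn ℂ G (slitDisk r ε L)) (F : ℂ → LogPuiseuxSeries) (K : ℂ → ℕ) {J : ℕ}
    (hF : ∀ p ∈ L, (fun z => G z - (F p).partialSum (K p) (z / p))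
      =O[𝓝[slitPlaneAt p] p] fun z => (z - p) ^ J) :
    (fun n => a n * (r : ℂ) ^ n - ∑ p ∈ L, (F p).partialSumCoeff (K p) n * (r / p) ^ n)
      =O[atTop] fun n : ℕ => ((n : ℝ) ^ J)⁻¹ := by
  set T : ℂ → ℂ → ℂ := fun p z => (F p).partialSum (K p) (z / p)
  have hL0 := ne_zero_of_forall_norm_eq hr hL
  have hT {p z : ℂ} (hz : z ∈ slitPlaneAt p) : AnalyticAt ℂ (T p) z :=
    AnalyticAt.fun_comp (g := (F p).partialSum (K p)) (f := (· / p))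
      ((F p).analyticAt_partialSum (K p) hz) analyticAt_id.div_const
  have hR : DifferentiableOn ℂ (fun z => G z - ∑ p ∈ L, T p z) (slitDisk r ε L) :=
    hG.fun_sub (.fun_sum fun p hp z hz =>
      (hT (slitDisk_subset_slitPlaneAt hp (hL0 p hp) hz)).differentiableAt.differentiableWithinAt)
  have hb : ∀ᶠ z in 𝓝 (0 : ℂ), HasSum
      (fun n => (a n - ∑ p ∈ L, (F p).partialSumCoeff (K p) n * p⁻¹ ^ n) * z ^ n)
      (G z - ∑ p ∈ L, T p z) := by
    filter_upwards [hGa, Metric.ball_mem_nhds 0 hr] with z hz hzr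
    refine (hz.sub (hasSum_sum fun p hp => (F p).hasSum_partialSumCoeff (K p) (?_ : ‖z / p‖ < 1))
      ).congr_fun fun n => ?_
    · rwa [norm_div, hL p hp, div_lt_one hr, ← mem_ball_zero_iff]
    · simp only [sub_mul, Finset.sum_mul, mul_assoc, ← mul_pow, inv_mul_eq_div]
  refine (isBigO_coeff_of_isBigO_sub hr hε hL hb hR fun p hp =>
    ⟨fun z => -∑ q ∈ L.erase p, T q z, ?_, ?_⟩).congr_left fun n => ?_
  · refine (Finset.analyticAt_fun_sum _ fun q hq => hT ?_).fun_neg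
    obtain ⟨hqp, hq⟩ := Finset.mem_erase.1 hq
    exact mem_slitPlaneAt_of_norm_le (hL0 q hq) ((hL p hp).trans (hL q hq).symm).le hqp.symm
  · refine (hF p hp).congr_left fun z => ?_
    rw [Pi.sub_apply, ← Finset.add_sum_erase L (T · z) hp]
    ring
  · simp only [sub_mul, Finset.sum_mul, mul_assoc, ← mul_pow, inv_mul_eq_div]

theorem exists_forall_isBigO_sub_sum_nilssonMonomial {a : ℕ → ℂ} {G : ℂ → ℂ} {r ε : ℝ} (hr : 0 < r)
    (hε : 0 < ε) {L : Finset ℂ} (hL : ∀ p ∈ L, ‖p‖ = r)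
    (hGa : ∀ᶠ z in 𝓝 (0 : ℂ), HasSum (fun n => a n * z ^ n) (G z))
    (hG : DifferentiableOn ℂ G (slitDisk r ε L))
    (hF : ∀ p ∈ L, ∃ F, HasLogPuiseuxExpansionAt G p F) :
    ∃ (S : Finset ℚ) (d : ℕ) (c : ℚ × ℕ → ℂ → ℂ), ∀ J : ℕ,
      (fun n => a n * (r : ℂ) ^ n - ∑ ω ∈ nilssonSegment S d (J, 0),
        (nilssonMonomial ω n : ℂ) * ∑ p ∈ L, c ω p * (r / p) ^ n)
        =O[atTop] fun n : ℕ => ((n : ℝ) ^ J)⁻¹ := by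
  choose! F hF using hF
  choose S d c hc hexp using fun p => (F p).exists_hasNilssonExpansionTo_partialSumCoeff
  refine ⟨L.biUnion S, L.sup d, fun ω p => c p ω, fun J => ?_⟩
  choose! K hK hKexp using fun p (hp : p ∈ L) => ((hF p hp J).and (hexp p J)).exists
  have hsum (p) (hp : p ∈ L) := (hKexp p hp).isBigO_sub_sum
    (P := nilssonSegment (L.biUnion S) (L.sup d) (J, 0)) fun ω hω hcω => by
      by_contra! hle
      refine hω ((mem_nilssonSegment_natCast).2 ⟨?_, hle⟩)
      exact nilssonIndex_mono (Finset.subset_biUnion_of_mem S hp) (Finset.le_sup hp) (hc p ω hcω)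
  have hbdd (p) (hp : p ∈ L) : (fun n : ℕ => ((r : ℂ) / p) ^ n) =O[atTop] fun _ => (1 : ℝ) :=
    .of_bound 1 (.of_forall fun n => by simp [hL p hp, abs_of_pos hr, hr.ne'])
  have hsum' := Asymptotics.IsBigO.fun_sum fun p hp => (hsum p hp).mul (hbdd p hp)
  simp only [mul_one] at hsum'
  refine ((isBigO_sub_sum_partialSumCoeff hr hε hL hGa hG F K hK).add hsum').congr_left fun n => ?_
  simp only [sub_mul, Finset.sum_sub_distrib, Finset.sum_mul, Finset.mul_sum, mul_assoc]
  rw [Finset.sum_comm, sub_add_sub_cancel]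

theorem theorem4p1_general (a : ℕ → ℂ) (r ε : ℝ) (hr : 0 < r) (hε : 0 < ε)
    (L : Finset ℂ) (hLr : ∀ p ∈ L, ‖p‖ = r) (G : ℂ → ℂ)
    (hGa : ∀ᶠ z in 𝓝 (0 : ℂ), HasSum (fun n : ℕ => a n * z ^ n) (G z))
    (hG : DifferentiableOn ℂ G (slitDisk r ε L))
    (hsing : ∃ p ∈ L, IsSingularBoundaryPoint G r p)
    (hmon : ∀ p ∈ L, HasQuasiUnipotentMonodromyAt G p) : IsNilssonType a := by
  have hL0 := ne_zero_of_forall_norm_eq hr hLr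
  obtain ⟨S, d, c, hc⟩ := exists_forall_isBigO_sub_sum_nilssonMonomial hr hε hLr hGa hG
    fun p hp => (hmon p hp).exists_hasLogPuiseuxExpansionAt (hL0 p hp)
  refine isNilssonType_of_isBigO hr hLr hc ?_
  by_contra! hzero
  obtain ⟨p, hp, hpsing⟩ := hsing
  have hdecay (J : ℕ) : (fun n => a n * (r : ℂ) ^ n) =O[atTop] fun n : ℕ => ((n : ℝ) ^ J)⁻¹ := by
    refine (hc J).congr_left fun n => ?_
    rw [Finset.sum_eq_zero fun ω hω => ?_, sub_zero]
    rw [Finset.sum_eq_zero fun q hq => ?_, mul_zero]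
    rw [hzero ω (mem_nilssonSegment_natCast.1 hω).1 q hq, zero_mul]
  have hball : DifferentiableOn ℂ G (Metric.ball 0 r) := hG.mono (ball_subset_slitDisk hr hε hLr)
  obtain rfl := hLr p hp
  exact (hmon p hp).not_isSingularBoundaryPoint (hL0 p hp) hGa hball hdecay hpsing

theorem theorem4p1 (a : ℕ → ℂ) (ha : ExponentiallyBounded a)
    (r ε : ℝ) (hr : 0 < r) (hε : 0 < ε)
    (L : Finset ℂ) (hL : L.Nonempty) (hLr : ∀ p ∈ L, ‖p‖ = r)
    (G : ℂ → ℂ)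
    (hGa : ∀ᶠ z in 𝓝 (0 : ℂ), HasSum (fun n : ℕ => a n * z ^ n) (G z))
    (hG : DifferentiableOn ℂ G (slitDisk r ε L))
    (hsing : ∀ p ∈ L, IsSingularBoundaryPoint G r p)
    (hmon : ∀ p ∈ L, HasQuasiUnipotentMonodromyAt G p) :
    IsNilssonType a :=
  theorem4p1_general a r ε hr hε L hLr G hGa hG (hL.imp fun p hp => ⟨hp, hsing p hp⟩) hmon
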